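/- There is an absolute constant $C>0$ such that the following holds. Let $n\ge 2$ and let $W\in[0,1]^{n\times n}$ be a symmetric, doubly stochastic, primitive matrix with eigenvalues $1=\lambda_1>\lambda_2\ge\dots\ge\lambda_n>-1$. Let $f_i(x)=\mathbb E_{\xi\sim\mathcal D_i}[F_i(x,\xi)]$, $i=1,\dots,n$, be functions $\mathbb R^d\to\mathbb R$ that are $L$-smooth ($\|\nabla f_i(x)-\nabla f_i(y)\|\le L\|x-y\|$) and $\mu$-strongly convex ($f_i(x)-f_i(y)+\frac\mu2\|x-y\|^2\le\langle\nabla f_i(x),x-y\rangle$) with $0<\mu\le L$, and let $x^\star$ be a minimizer of $f=\frac1n\sum_{i=1}^n f_i$. Let $0<p\le1$, $0<\alpha\le\frac1{2L}$ and $$\chi>\max\Big\{\frac1p,\ \frac{36}{1-\lambda_2},\ \frac{72(1-p)}{1-\lambda_2}\Big\}.$$ ProxSkip with $\beta=p$ starts from $x_i^0=x^0\in\mathbb R^d$ and $y_i^0=0$ for all $i$. At iteration $t\ge0$ every node computes $g_i^t=\nabla F_i(x_i^t,\xi_i^t)$ and $\hat z_i^t=x_i^t-\alpha g_i^t-y_i^t$.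 If $\theta_t=1$, then $x_i^{t+1}=\sum_{j=1}^n\widetilde W_{ij}\hat z_j^t$ with $\widetilde W=I-\frac1{2\chi}(I-W)$; if $\theta_t=0$, then $x_i^{t+1}=\hat z_i^t$. In both cases $y_i^{t+1}=y_i^t+p(\hat z_i^t-x_i^{t+1})$. The samples $\xi_i^t\sim\mathcal D_i$ and the coins $\theta_t\in\{0,1\}$ with $\mathbb P(\theta_t=1)=p$ are all mutually independent. For some $\sigma\ge0$ and all $t\ge 0$, the stochastic gradients satisfy $\mathbb E[g_i^t\mid x_i^t]=\nabla f_i(x_i^t)$ for all $i$, and $\frac1n\sum_{i=1}^n\mathbb E\|g_i^t-\nabla f_i(x_i^t)\|^2\le\sigma^2$. Put $\bar x^t=\frac1n\sum_{i=1}^n x_i^t$ and $$\tilde\gamma_{\mathrm s}=\sqrt{1-\tfrac{1-\lambda_2}{2\chi}}+\tfrac{3(1-p)(2+p^2)}{\chi^2},\qquad \zeta=\max\Big\{1-\alpha\mu,\,1-\tfrac{(1-\lambda_2)p^2}{2\chi}\Big\},\qquad \tilde\zeta_0=\max\Big\{1-\alpha\mu,\,\sqrt{1-\tfrac{(1-\lambda_2)p^2}{2\chi}}\Big\}.$$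 Then $\tilde\gamma_{\mathrm s}<1$, $\tilde\zeta_0<1$, and there is a constant $a_0$, depending on $x^0$, the $f_i$, $W$, $\mu$, $L$, $\alpha$, $p$, $\chi$, but not on $t$, on the stochastic gradients or on $\sigma$, such that for all $t\ge0$ $$\mathbb E\big\|\bar x^{t+1}-x^\star\big\|^2\ \le\ \tilde\zeta_0^{\,t+1}a_0+C\left(\frac{\alpha^4\sigma^2L^3\chi^4}{\mu p^2(1-\lambda_2)^2(1-\zeta)}+\frac{\alpha^2\sigma^2L\chi^3}{\mu p^2(1-\lambda_2)}\right)+\frac{\alpha\sigma^2}{n\mu}.$$ In particular the linear-speedup term $\frac{\alpha\sigma^2}{n\mu}$ is obtained with a step size that does not depend on the network. -/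

import Mathlib

open MeasureTheory ProbabilityTheory

universe u v

noncomputable section

namespace ProxSkip

/-- The space of local decision variables, `ℝᵈ` with the Euclidean norm. -/
abbrev Vec (d : ℕ) := EuclideanSpace ℝ (Fin d)

/-- Stacked variables: one vector of `ℝᵈ` per node (the rows of an `n × d` matrix). -/
abbrev Stack (n d : ℕ) := Fin n → Vec d

/-- The mean `(1/n) ∑ᵢ xᵢ` of the local variables. -/
def nodeMean {n d : ℕ} (X : Stack n d) : Vec d := (1 / (n : ℝ)) • ∑ i, X i

/-! ### The network -/

/-- Mixing matrices: symmetric, doubly stochastic and primitive. -/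
structure IsMixingMatrix {n : ℕ} (W : Matrix (Fin n) (Fin n) ℝ) : Prop where
  symm : W.IsSymm
  stochastic : W ∈ doublyStochastic ℝ (Fin n)
  primitive : W.IsPrimitive

theorem IsMixingMatrix.isHermitian {n : ℕ} {W : Matrix (Fin n) (Fin n) ℝ}
    (hW : IsMixingMatrix W) : W.IsHermitian := by
  have h := hW.symm
  rw [Matrix.IsHermitian, Matrix.conjTranspose_eq_transpose_of_trivial]
  exact h

/-- The second largest eigenvalue `λ₂` of a mixing matrix, counted with multiplicity
(Mathlib lists the eigenvalues in decreasing order, starting from the index `0`). -/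
def IsMixingMatrix.lambda2 {n : ℕ} {W : Matrix (Fin n) (Fin n) ℝ}
    (hW : IsMixingMatrix W) (hn : 2 ≤ n) : ℝ :=
  hW.isHermitian.eigenvalues₀ ⟨1, by rw [Fintype.card_fin]; omega⟩

/-- `W_a = I - (1 / (2χ)) (I - W)`. -/
def mixingA {n : ℕ} (χ : ℝ) (W : Matrix (Fin n) (Fin n) ℝ) : Matrix (Fin n) (Fin n) ℝ :=
  1 - (1 / (2 * χ)) • (1 - W)

/-- The product of an `n × n` matrix with a stacked variable. -/
def mix {n d : ℕ} (A : Matrix (Fin n) (Fin n) ℝ) (Z : Stack n d) : Stack n d :=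
  fun i => ∑ j, A i j • Z j

/-! ### The objective -/

/-- The global objective `f = (1/n) ∑ᵢ fᵢ`. -/
def globalLoss {n d : ℕ} (f : Fin n → Vec d → ℝ) (x : Vec d) : ℝ :=
  (1 / (n : ℝ)) * ∑ i, f i x

/-- `g` is differentiable with `L`-Lipschitz gradient. -/
def IsSmooth {d : ℕ} (L : ℝ) (g : Vec d → ℝ) : Prop :=
  Differentiable ℝ g ∧ ∀ x y, ‖gradient g x - gradient g y‖ ≤ L * ‖x - y‖

/-- `g` is `μ`-strongly convex (first-order form). -/
def IsStronglyConvex {d : ℕ} (μ : ℝ) (g : Vec d → ℝ) : Prop :=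
  ∀ x y, g x - g y + μ / 2 * ‖x - y‖ ^ 2 ≤ inner ℝ (gradient g x) (x - y)

/-- `fᵢ(x) = 𝔼_{ξ ∼ Dᵢ} [Fᵢ(x, ξ)]` for every node, where `Fᵢ(·, ξ)` is differentiable at every
point for almost every `ξ` and `∇Fᵢ` is jointly measurable. -/
structure IsStochasticLoss {n d : ℕ} (f : Fin n → Vec d → ℝ) {Ξ : Fin n → Type u}
    [∀ i, MeasurableSpace (Ξ i)] (D : ∀ i, Measure (Ξ i))
    (F : ∀ i, Vec d → Ξ i → ℝ) : Prop where
  prob : ∀ i, IsProbabilityMeasure (D i)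
  integrable : ∀ i x, Integrable (F i x) (D i)
  eq_integral : ∀ i x, f i x = ∫ s, F i x s ∂(D i)
  differentiable : ∀ i x, ∀ᵐ s ∂(D i), DifferentiableAt ℝ (fun y => F i y s) x
  measurable_gradient : ∀ i,
    Measurable (fun z : Vec d × Ξ i => gradient (fun y => F i y z.2) z.1)

/-! ### The algorithm -/

/-- One iteration of ProxSkip, from `(X, Y)`, with the coin `θ` and the stochastic gradients `G`. -/
def step {n d : ℕ} (α β : ℝ) (Wa : Matrix (Fin n) (Fin n) ℝ) (θ : Bool) (G : Stack n d)
    (S : Stack n d × Stack n d) : Stack n d × Stack n d :=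
  let Z : Stack n d := S.1 - α • G - S.2
  let X' : Stack n d := if θ then mix Wa Z else Z
  (X', S.2 + β • (Z - X'))

/-- The stochastic gradients `∇Fᵢ(xᵢ, ξᵢ)` at the local variables `X`. -/
def stochGrad {n d : ℕ} {Ξ : Fin n → Type u} (F : ∀ i, Vec d → Ξ i → ℝ)
    (X : Stack n d) (s : ∀ i, Ξ i) : Stack n d :=
  fun i => gradient (fun y => F i y (s i)) (X i)

/-- The iterates `(Xᵗ, Yᵗ)` of ProxSkip for given samples `ξ` and coins `θ`, started at
`xᵢ⁰ = x⁰` and `yᵢ⁰ = 0` for all nodes `i`. -/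
def iterates {n d : ℕ} {Ξ : Fin n → Type u} (F : ∀ i, Vec d → Ξ i → ℝ)
    (W : Matrix (Fin n) (Fin n) ℝ) (α β χ : ℝ) (x₀ : Vec d)
    (ξ : ℕ → ∀ i, Ξ i) (θ : ℕ → Bool) : ℕ → Stack n d × Stack n d
  | 0 => (fun _ => x₀, fun _ => 0)
  | t + 1 =>
    let S := iterates F W α β χ x₀ ξ θ t
    step α β (mixingA χ W) (θ t) (stochGrad F S.1 (ξ t)) S

/-! ### The randomness -/

/-- The samples `ξᵢᵗ ∼ Dᵢ` and the coins `θ_t ∼ Bernoulli(p)` are random variables, all of them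
mutually independent. -/
structure IsSampling {n : ℕ} {Ξ : Fin n → Type u} [∀ i, MeasurableSpace (Ξ i)]
    (D : ∀ i, Measure (Ξ i)) (p : ℝ) {Ω : Type v} [MeasurableSpace Ω] (P : Measure Ω)
    (ξ : ℕ → ∀ i, Ω → Ξ i) (θ : ℕ → Ω → Bool) : Prop where
  measurable_sample : ∀ t i, Measurable (ξ t i)
  law_sample : ∀ t i, P.map (ξ t i) = D i
  measurable_coin : ∀ t, Measurable (θ t)
  law_coin : ∀ t, P {ω | θ t ω = true} = ENNReal.ofReal p
  indep : iIndep
    (Sum.elim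
      (fun k : ℕ × Fin n => MeasurableSpace.comap (ξ k.1 k.2) inferInstance)
      (fun t : ℕ => MeasurableSpace.comap (θ t) inferInstance)) P

/-- Along the random iterates `x t i ω`, the stochastic gradients `g t i ω` are unbiased estimates
of `∇fᵢ`, and their variance, averaged over the nodes, is at most `σ²`. -/
structure HasUnbiasedGradients {n d : ℕ} (f : Fin n → Vec d → ℝ) (σ : ℝ)
    {Ω : Type v} [MeasurableSpace Ω] (P : Measure Ω)
    (x g : ℕ → Fin n → Ω → Vec d) : Prop where
  unbiased : ∀ t i,
    P[g t i | MeasurableSpace.comap (x t i) inferInstance]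
      =ᵐ[P] fun ω => gradient (f i) (x t i ω)
  memLp : ∀ t i, MemLp (fun ω => g t i ω - gradient (f i) (x t i ω)) 2 P
  variance_le : ∀ t,
    (1 / (n : ℝ)) * ∑ i, ∫ ω, ‖g t i ω - gradient (f i) (x t i ω)‖ ^ 2 ∂P ≤ σ ^ 2

/-! ### The constants of the rate -/

/-- `γ̃ₛ = √(1 - (1 - λ₂) / (2χ)) + 3 (1 - p) (2 + p²) / χ²`. -/
def gammaS (lam p χ : ℝ) : ℝ :=
  Real.sqrt (1 - (1 - lam) / (2 * χ)) + 3 * (1 - p) * (2 + p ^ 2) / χ ^ 2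

/-- `ζ = max {1 - αμ, 1 - (1 - λ₂) p² / (2χ)}`. -/
def zeta (lam p χ α μ : ℝ) : ℝ :=
  max (1 - α * μ) (1 - (1 - lam) * p ^ 2 / (2 * χ))

/-- `ζ̃₀ = max {1 - αμ, √(1 - (1 - λ₂) p² / (2χ))}`. -/
def zetaTilde (lam p χ α μ : ℝ) : ℝ :=
  max (1 - α * μ) (Real.sqrt (1 - (1 - lam) * p ^ 2 / (2 * χ)))

end ProxSkip

end

-- Everything is centred at the optimum. Let `H = I - W_a`, let `Q` be the projection onto stacks of
-- mean zero, and put `w = (1 - λ₂) / (2χ)`, so that `w Q ≤ H ≤ 1/χ`. The gradients at the minimizer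
-- sum to zero, hence lie in the range of `H`, and the dual iterates can be written `Y = H s - α
-- ∇f(x⋆)`, with `∇f(x⋆)` the stack of local gradients. With `x = X - x⋆`, gradient error `γ` and
-- noise `ν`, an iteration forms `z = x - αγ - H s - αν`; the coin then decides between `(z - H z, s
-- + p z)` and `(z, s)`.
--
-- Two quantities are followed: `E = 𝔼‖x - Q x‖²`, which is `n` times the error of the average, and
-- the consensus energy `V = 𝔼[‖Q x‖² + p⁻²⟨s, H s⟩]`. Averaging the energy over the coin is an
-- exact computation (`lyapunov_mean_coin`): the plain gradient step `z + H s` reappears, diminished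
-- by `‖H s‖²` and by the gossip dissipation `p (⟨z, H z⟩ - ‖H z‖²)`. Three recursions follow.
--
-- (1) `integral_total_succ_le`: `E + V` contracts with factor `max (1 - 3αμ/2) (1 - p²w)`, with
-- noise `α²nσ²`. Alone, this gives no speedup in `n`.
--
-- (2) `integral_lyapunov_contract`: the dissipation makes `V` contract at a rate free of `αμ`, the
-- gradients being a perturbation of size `α²L²/(pw) · (E + V)`.
--
-- (3) `integral_mean_succ_le`: `E` contracts with factor `1 - αμ`, is driven by `2αL V`, and
-- receives noise `α²σ²` only, because the noises of distinct nodes are orthogonal.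
--
-- Feeding (1) into (2) and (2) into (3) gives the bound: after division by `n` the noise in (3)
-- yields `ασ²/(nμ)`, and the noise that passes through `V` yields the two terms with constant `C`.
-- The factors in (1) and (2) are strictly below `zetaTilde`, so convolving the geometric sequences
-- costs a constant and no factor `t`.

noncomputable section

namespace ProxSkip

/-! ### The spectrum of a mixing matrix -/

section Spectrum

open Matrix

variable {n : ℕ}

/-- Row and column sums equal to one turn the diagonal parts into `v ⬝ᵥ v`. The signs `c = ±1` give
`-I ≤ M ≤ I`, and `c = 1` also identifies the fixed vectors. -/
theorem sum_mul_sub_sq_of_doublyStochastic {M : Matrix (Fin n) (Fin n) ℝ}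
    (hM : M ∈ doublyStochastic ℝ (Fin n)) (v : Fin n → ℝ) (c : ℝ) :
    ∑ i, ∑ j, M i j * (v i - c * v j) ^ 2
      = (1 + c ^ 2) * (v ⬝ᵥ v) - 2 * c * (v ⬝ᵥ M *ᵥ v) := by
  have h1 : ∑ i, ∑ j, M i j * v i ^ 2 = v ⬝ᵥ v := by
    simp only [dotProduct, ← Finset.sum_mul, sum_row_of_mem_doublyStochastic hM, one_mul, sq]
  have h2 : ∑ i, ∑ j, M i j * v j ^ 2 = v ⬝ᵥ v := by
    rw [Finset.sum_comm]
    simp only [dotProduct, ← Finset.sum_mul, sum_col_of_mem_doublyStochastic hM, one_mul, sq]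
  have h3 : ∑ i, ∑ j, M i j * (v i * v j) = v ⬝ᵥ M *ᵥ v := by
    simp only [dotProduct, mulVec, Finset.mul_sum]
    exact Finset.sum_congr rfl fun i _ => Finset.sum_congr rfl fun j _ => by ring
  calc ∑ i, ∑ j, M i j * (v i - c * v j) ^ 2
      = ∑ i, ∑ j, (M i j * v i ^ 2 + c ^ 2 * (M i j * v j ^ 2)
          - 2 * c * (M i j * (v i * v j))) := by
        exact Finset.sum_congr rfl fun i _ => Finset.sum_congr rfl fun j _ => by ring
    _ = _ := by
        simp only [Finset.sum_sub_distrib, Finset.sum_add_distrib, ← Finset.mul_sum]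
        rw [h1, h2, h3]; ring

theorem sum_nonneg_of_doublyStochastic {M : Matrix (Fin n) (Fin n) ℝ}
    (hM : M ∈ doublyStochastic ℝ (Fin n)) (v : Fin n → ℝ) (c : ℝ) :
    0 ≤ ∑ i, ∑ j, M i j * (v i - c * v j) ^ 2 :=
  Finset.sum_nonneg fun _ _ => Finset.sum_nonneg fun _ _ =>
    mul_nonneg (nonneg_of_mem_doublyStochastic hM) (sq_nonneg _)

theorem dotProduct_mulVec_le {M : Matrix (Fin n) (Fin n) ℝ}
    (hM : M ∈ doublyStochastic ℝ (Fin n)) (v : Fin n → ℝ) : v ⬝ᵥ M *ᵥ v ≤ v ⬝ᵥ v := by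
  have h := sum_nonneg_of_doublyStochastic hM v 1
  rw [sum_mul_sub_sq_of_doublyStochastic hM] at h
  linarith

theorem neg_le_dotProduct_mulVec {M : Matrix (Fin n) (Fin n) ℝ}
    (hM : M ∈ doublyStochastic ℝ (Fin n)) (v : Fin n → ℝ) : -(v ⬝ᵥ v) ≤ v ⬝ᵥ M *ᵥ v := by
  have h := sum_nonneg_of_doublyStochastic hM v (-1)
  rw [sum_mul_sub_sq_of_doublyStochastic hM] at h
  linarith

/-- Vectors fixed by a primitive doubly stochastic matrix are constant. -/
theorem IsMixingMatrix.eq_of_mulVec_eq {W : Matrix (Fin n) (Fin n) ℝ} (hW : IsMixingMatrix W)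
    {v : Fin n → ℝ} (hv : W *ᵥ v = v) (i j : Fin n) : v i = v j := by
  obtain ⟨k, -, hk⟩ := hW.primitive.exists_pos_pow
  have hpow : ∀ m : ℕ, (W ^ m) *ᵥ v = v := by
    intro m
    induction m with
    | zero => simp
    | succ m ih => rw [pow_succ, ← mulVec_mulVec, hv, ih]
  have hM : W ^ k ∈ doublyStochastic ℝ (Fin n) := pow_mem hW.stochastic k
  -- The Dirichlet form of `W ^ k` vanishes at a fixed vector, and all its weights are positive.
  have h := sum_mul_sub_sq_of_doublyStochastic hM v 1
  rw [hpow k] at h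
  have h0 : ∑ i, ∑ j, (W ^ k) i j * (v i - 1 * v j) ^ 2 = 0 := by rw [h]; ring
  have hterm : ∀ a b, 0 ≤ (W ^ k) a b * (v a - 1 * v b) ^ 2 := fun a b =>
    mul_nonneg (hk a b).le (sq_nonneg _)
  rw [Finset.sum_eq_zero_iff_of_nonneg
    (fun a _ => Finset.sum_nonneg fun b _ => hterm a b)] at h0
  have h1 := h0 i (Finset.mem_univ i)
  rw [Finset.sum_eq_zero_iff_of_nonneg (fun b _ => hterm i b)] at h1
  have h2 := h1 j (Finset.mem_univ j)
  rcases mul_eq_zero.1 h2 with h3 | h3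
  · exact absurd h3 (hk i j).ne'
  · have := pow_eq_zero_iff (two_ne_zero) |>.1 h3
    linarith

/-- An eigenvector for an eigenvalue at least `1` is constant. -/
theorem IsMixingMatrix.eq_of_mulVec_eq_smul {W : Matrix (Fin n) (Fin n) ℝ}
    (hW : IsMixingMatrix W) {v : Fin n → ℝ} {r : ℝ} (hr : 1 ≤ r)
    (hv : W *ᵥ v = r • v) (i j : Fin n) : v i = v j := by
  have h := dotProduct_mulVec_le hW.stochastic v
  rw [hv, dotProduct_smul, smul_eq_mul] at h
  have h0 : 0 ≤ v ⬝ᵥ v := dotProduct_self_star_nonneg v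
  rcases h0.eq_or_lt with h1 | h1
  · have : v = 0 := dotProduct_self_eq_zero.1 h1.symm
    simp [this]
  · have : r = 1 := by nlinarith
    exact hW.eq_of_mulVec_eq (by rw [hv, this, one_smul]) i j

/-- The position of the largest eigenvalue. -/
def topIndex (hn : 2 ≤ n) : Fin n :=
  Fintype.equivOfCardEq (Fintype.card_fin (Fintype.card (Fin n))) ⟨0, by rw [Fintype.card_fin]; omega⟩

/-- The position of the second largest eigenvalue. -/
def secondIndex (hn : 2 ≤ n) : Fin n :=
  Fintype.equivOfCardEq (Fintype.card_fin (Fintype.card (Fin n))) ⟨1, by rw [Fintype.card_fin]; omega⟩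

theorem topIndex_ne_secondIndex (hn : 2 ≤ n) : topIndex hn ≠ secondIndex hn := by
  intro h
  have := (Fintype.equivOfCardEq (Fintype.card_fin (Fintype.card (Fin n)))).injective h
  simp at this

variable {W : Matrix (Fin n) (Fin n) ℝ} (hW : IsMixingMatrix W) (hn : 2 ≤ n)

theorem IsMixingMatrix.eigenvalues_secondIndex :
    hW.isHermitian.eigenvalues (secondIndex hn) = hW.lambda2 hn := by
  simp [Matrix.IsHermitian.eigenvalues, secondIndex, IsMixingMatrix.lambda2]

theorem IsMixingMatrix.lambda2_le_eigenvalues_topIndex :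
    hW.lambda2 hn ≤ hW.isHermitian.eigenvalues (topIndex hn) := by
  simp only [Matrix.IsHermitian.eigenvalues, topIndex, IsMixingMatrix.lambda2,
    Equiv.symm_apply_apply]
  exact hW.isHermitian.eigenvalues₀_antitone (by simp [Fin.le_def])

theorem IsMixingMatrix.eigenvalues_le_lambda2 {i : Fin n} (hi : i ≠ topIndex hn) :
    hW.isHermitian.eigenvalues i ≤ hW.lambda2 hn := by
  simp only [Matrix.IsHermitian.eigenvalues, IsMixingMatrix.lambda2]
  apply hW.isHermitian.eigenvalues₀_antitone
  rw [Fin.le_def]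
  by_contra h
  apply hi
  rw [topIndex, ← Equiv.symm_apply_eq]
  ext
  simp only at h ⊢
  omega

/-- Otherwise the first two eigenvectors would both be constant, and two constant vectors of norm
one cannot be orthogonal. -/
theorem IsMixingMatrix.lambda2_lt_one : hW.lambda2 hn < 1 := by
  by_contra! h
  set b := hW.isHermitian.eigenvectorBasis
  have hb0 := hW.eq_of_mulVec_eq_smul (h.trans (hW.lambda2_le_eigenvalues_topIndex hn))
    (hW.isHermitian.mulVec_eigenvectorBasis (topIndex hn))
  have hb1 := hW.eq_of_mulVec_eq_smul (h.trans (hW.eigenvalues_secondIndex hn).ge)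
    (hW.isHermitian.mulVec_eigenvectorBasis (secondIndex hn))
  let z : Fin n := ⟨0, by omega⟩
  have hn0 : (n : ℝ) ≠ 0 := by
    have : n ≠ 0 := by omega
    exact_mod_cast this
  have hi : ∀ k l : Fin n, inner ℝ (b k) (b l) = ∑ i, (b k) i * (b l) i := by
    intro k l
    rw [PiLp.inner_apply]
    exact Finset.sum_congr rfl fun i _ => by simp [mul_comm]
  have horth : inner ℝ (b (topIndex hn)) (b (secondIndex hn)) = 0 :=
    b.orthonormal.2 (topIndex_ne_secondIndex hn)
  have hn0' := b.orthonormal.1 (topIndex hn)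
  have hn1' := b.orthonormal.1 (secondIndex hn)
  have e0 : inner ℝ (b (topIndex hn)) (b (topIndex hn)) = 1 := by
    rw [real_inner_self_eq_norm_sq, hn0']; norm_num
  have e1 : inner ℝ (b (secondIndex hn)) (b (secondIndex hn)) = 1 := by
    rw [real_inner_self_eq_norm_sq, hn1']; norm_num
  rw [hi] at horth e0 e1
  have c0 : ∀ i, (b (topIndex hn)) i = (b (topIndex hn)) z := fun i => hb0 i z
  have c1 : ∀ i, (b (secondIndex hn)) i = (b (secondIndex hn)) z := fun i => hb1 i z
  simp only [c0, c1, Finset.sum_const, Finset.card_univ, Fintype.card_fin, nsmul_eq_mul]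
    at horth e0 e1
  rcases mul_eq_zero.1 horth with h' | h'
  · exact hn0 h'
  · rcases mul_eq_zero.1 h' with h' | h' <;> simp [h'] at e0 e1

/-- The spectral gap: on vectors with mean zero, `I - W ≥ 1 - λ₂`. -/
theorem IsMixingMatrix.dotProduct_mulVec_le_lambda2 {v : Fin n → ℝ} (hv : ∑ i, v i = 0) :
    v ⬝ᵥ W *ᵥ v ≤ hW.lambda2 hn * (v ⬝ᵥ v) := by
  set b := hW.isHermitian.eigenvectorBasis with hb
  set ev := hW.isHermitian.eigenvalues with hev
  let x : EuclideanSpace ℝ (Fin n) := WithLp.toLp 2 v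
  let e : EuclideanSpace ℝ (Fin n) := WithLp.toLp 2 1
  have hsymm : ∀ a c : Fin n → ℝ, a ⬝ᵥ W *ᵥ c = (W *ᵥ a) ⬝ᵥ c := by
    intro a c
    rw [dotProduct_mulVec, ← mulVec_transpose, hW.symm]
  have hin : ∀ a c : EuclideanSpace ℝ (Fin n), inner ℝ a c = a.ofLp ⬝ᵥ c.ofLp := by
    intro a c
    rw [EuclideanSpace.inner_eq_star_dotProduct, dotProduct_comm]
    simp
  have heig : ∀ i (c : Fin n → ℝ), (b i).ofLp ⬝ᵥ W *ᵥ c = ev i * ((b i).ofLp ⬝ᵥ c) := by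
    intro i c
    rw [hsymm, hW.isHermitian.mulVec_eigenvectorBasis, smul_dotProduct, smul_eq_mul]
  -- The all-ones vector is fixed by `W`, so it is orthogonal to eigenvectors whose eigenvalue is
  -- below one.
  have hone : ∀ i, i ≠ topIndex hn → inner ℝ (b i) e = 0 := by
    intro i hi
    have h1 := heig i 1
    rw [mulVec_one_of_mem_doublyStochastic hW.stochastic] at h1
    have h2 := (hW.eigenvalues_le_lambda2 hn hi).trans_lt (hW.lambda2_lt_one hn)
    rw [hin]
    have h3 : (1 - ev i) * ((b i).ofLp ⬝ᵥ (1 : Fin n → ℝ)) = 0 := by linarith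
    rcases mul_eq_zero.1 h3 with h4 | h4
    · linarith
    · exact h4
  have hex : inner ℝ e x = 0 := by
    rw [hin]; simpa [e, x, dotProduct] using hv
  have hee : inner ℝ e e = (n : ℝ) := by
    rw [hin]; simp [e, dotProduct]
  -- In the expansion of `⟨e, x⟩ = 0` only the top term survives, and `⟨e, b_top⟩ ≠ 0` because `⟨e,
  -- e⟩ = n`. Hence a vector of mean zero has no top component.
  have htop : inner ℝ (b (topIndex hn)) x = 0 := by
    have h1 := b.sum_inner_mul_inner e x
    rw [hex, Finset.sum_eq_single (topIndex hn)] at h1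
    · rcases mul_eq_zero.1 h1 with h2 | h2
      · have h3 := b.sum_inner_mul_inner e e
        rw [hee, Finset.sum_eq_single (topIndex hn), h2, zero_mul] at h3
        · have : (n : ℝ) ≠ 0 := by
            have : n ≠ 0 := by omega
            exact_mod_cast this
          exact absurd h3.symm this
        · intro i _ hi; rw [hone i hi, mul_zero]
        · simp
      · exact h2
    · intro i _ hi
      rw [real_inner_comm, hone i hi, zero_mul]
    · simp
  have e1 : v ⬝ᵥ v = ∑ i, inner ℝ (b i) x ^ 2 := by
    have h1 := b.sum_inner_mul_inner x x
    rw [hin x x] at h1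
    rw [show v ⬝ᵥ v = x.ofLp ⬝ᵥ x.ofLp from rfl, ← h1]
    exact Finset.sum_congr rfl fun i _ => by rw [real_inner_comm, sq]
  have e2 : v ⬝ᵥ W *ᵥ v = ∑ i, ev i * inner ℝ (b i) x ^ 2 := by
    have h1 := b.sum_inner_mul_inner x (WithLp.toLp 2 (W *ᵥ v))
    rw [hin x] at h1
    rw [show v ⬝ᵥ W *ᵥ v = x.ofLp ⬝ᵥ (WithLp.toLp 2 (W *ᵥ v)).ofLp from rfl, ← h1]
    refine Finset.sum_congr rfl fun i _ => ?_
    rw [hin (b i) (WithLp.toLp 2 (W *ᵥ v)), heig, real_inner_comm, hin]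
    ring
  rw [e1, e2, Finset.mul_sum]
  refine Finset.sum_le_sum fun i _ => ?_
  by_cases hi : i = topIndex hn
  · rw [hi, htop]; simp
  · exact mul_le_mul_of_nonneg_right (hW.eigenvalues_le_lambda2 hn hi) (sq_nonneg _)

theorem IsMixingMatrix.neg_one_le_lambda2 : -1 ≤ hW.lambda2 hn := by
  set b := hW.isHermitian.eigenvectorBasis
  have h := neg_le_dotProduct_mulVec hW.stochastic (b (secondIndex hn)).ofLp
  rw [hW.isHermitian.mulVec_eigenvectorBasis, hW.eigenvalues_secondIndex, dotProduct_smul,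
    smul_eq_mul] at h
  have h1 : (b (secondIndex hn)).ofLp ⬝ᵥ (b (secondIndex hn)).ofLp = 1 := by
    have h2 := real_inner_self_eq_norm_sq (b (secondIndex hn))
    rw [b.orthonormal.1, EuclideanSpace.inner_eq_star_dotProduct] at h2
    simpa using h2
  rw [h1] at h
  linarith

end Spectrum

/-! ### Smooth and strongly convex functions -/

section Convexity

variable {d : ℕ} {L μ : ℝ} {g : Vec d → ℝ}

/-- Along the segment from `x` to `y`, the function minus its quadratic upper model has nonpositive
derivative. -/
theorem IsSmooth.le_add_inner (hg : IsSmooth L g) (x y : Vec d) :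
    g y ≤ g x + inner ℝ (gradient g x) (y - x) + L / 2 * ‖y - x‖ ^ 2 := by
  set w := y - x with hw
  have hline : ∀ t : ℝ, HasDerivAt (fun t : ℝ => g (x + t • w))
      (inner ℝ (gradient g (x + t • w)) w) t := by
    intro t
    have h1 := (hg.1 (x + t • w)).hasFDerivAt
    have h2 : HasDerivAt (fun t : ℝ => x + t • w) w t := by
      simpa using ((hasDerivAt_id t).smul_const w).const_add x
    have h3 := h1.comp_hasDerivAt t h2
    rwa [← inner_gradient_left] at h3
  let φ : ℝ → ℝ := fun t =>
    g (x + t • w) - t * inner ℝ (gradient g x) w - L / 2 * ‖w‖ ^ 2 * t ^ 2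
  have hφ : ∀ t : ℝ, HasDerivAt φ (inner ℝ (gradient g (x + t • w)) w
      - inner ℝ (gradient g x) w - L * ‖w‖ ^ 2 * t) t := by
    intro t
    have h1 := ((hline t).sub ((hasDerivAt_id t).mul_const (inner ℝ (gradient g x) w))).sub
      ((hasDerivAt_pow 2 t).const_mul (L / 2 * ‖w‖ ^ 2))
    exact HasDerivAt.congr_deriv h1 (by simp; ring)
  have hanti : AntitoneOn φ (Set.Icc 0 1) := by
    apply antitoneOn_of_deriv_nonpos (convex_Icc 0 1)
    · exact fun t _ => (hφ t).continuousAt.continuousWithinAt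
    · exact fun t _ => (hφ t).differentiableAt.differentiableWithinAt
    · intro t ht
      rw [interior_Icc] at ht
      rw [(hφ t).deriv, ← inner_sub_left]
      have h1 := real_inner_le_norm (gradient g (x + t • w) - gradient g x) w
      have h2 := hg.2 (x + t • w) x
      rw [add_sub_cancel_left, norm_smul, Real.norm_of_nonneg ht.1.le] at h2
      have h3 := mul_le_mul_of_nonneg_right h2 (norm_nonneg w)
      nlinarith
  have h := hanti (Set.left_mem_Icc.2 zero_le_one) (Set.right_mem_Icc.2 zero_le_one) zero_le_one
  simp only [φ, one_smul, zero_smul, add_zero, hw, add_sub_cancel] at h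
  rw [← hw] at h
  linarith

theorem IsStronglyConvex.add_inner_le (hμ : 0 ≤ μ) (hc : IsStronglyConvex μ g) (x y : Vec d) :
    g x + inner ℝ (gradient g x) (y - x) ≤ g y := by
  have h := hc x y
  rw [← neg_sub y x, inner_neg_right, norm_neg] at h
  have : 0 ≤ μ / 2 * ‖y - x‖ ^ 2 := by positivity
  linarith

/-- The test point `y - u / L` minimizes the smooth upper model of `g` at `y` tilted by the gradient
at `x`; comparing with the convex lower bound at `x` gives the claim. -/
theorem IsStronglyConvex.norm_gradient_sub_sq_le (hμ : 0 ≤ μ) (hL : 0 < L) (hg : IsSmooth L g)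
    (hc : IsStronglyConvex μ g) (x y : Vec d) :
    ‖gradient g y - gradient g x‖ ^ 2
      ≤ 2 * L * (g y - g x - inner ℝ (gradient g x) (y - x)) := by
  set u := gradient g y - gradient g x with hu
  have h1 := hg.le_add_inner y (y - (1 / L) • u)
  have h2 := hc.add_inner_le hμ x (y - (1 / L) • u)
  have e1 : y - (1 / L) • u - y = -((1 / L) • u) := by abel
  have e2 : y - (1 / L) • u - x = (y - x) - (1 / L) • u := by abel
  rw [e1, inner_neg_right, inner_smul_right, norm_neg, norm_smul, Real.norm_of_nonneg
    (by positivity)] at h1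
  rw [e2, inner_sub_right, inner_smul_right] at h2
  have h3 : inner ℝ (gradient g y) u - inner ℝ (gradient g x) u = ‖u‖ ^ 2 := by
    rw [← inner_sub_left, ← hu, real_inner_self_eq_norm_sq]
  have h4 : L / 2 * (1 / L * ‖u‖) ^ 2 = 1 / (2 * L) * ‖u‖ ^ 2 := by field_simp
  rw [h4] at h1
  have h5 : 1 / L * inner ℝ (gradient g y) u - 1 / L * inner ℝ (gradient g x) u
      = 2 * (1 / (2 * L) * ‖u‖ ^ 2) := by
    rw [← mul_sub, h3]; field_simp
  have h6 : 1 / (2 * L) * ‖u‖ ^ 2 ≤ g y - g x - inner ℝ (gradient g x) (y - x) := by linarith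
  rw [div_mul_eq_mul_div, one_mul, div_le_iff₀ (by positivity)] at h6
  linarith

/-- Co-coercivity of the gradient. -/
theorem IsStronglyConvex.norm_gradient_sub_sq_le_inner (hμ : 0 ≤ μ) (hL : 0 < L)
    (hg : IsSmooth L g) (hc : IsStronglyConvex μ g) (x y : Vec d) :
    ‖gradient g x - gradient g y‖ ^ 2
      ≤ L * inner ℝ (gradient g x - gradient g y) (x - y) := by
  have h1 := hc.norm_gradient_sub_sq_le hμ hL hg x y
  have h2 := hc.norm_gradient_sub_sq_le hμ hL hg y x
  rw [norm_sub_rev, ← neg_sub x y, inner_neg_right] at h1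
  rw [inner_sub_left]
  linarith

theorem IsStronglyConvex.mul_norm_sq_le_inner (hc : IsStronglyConvex μ g) (x y : Vec d) :
    μ * ‖x - y‖ ^ 2 ≤ inner ℝ (gradient g x - gradient g y) (x - y) := by
  have h1 := hc x y
  have h2 := hc y x
  rw [← neg_sub x y, inner_neg_right, norm_neg] at h2
  rw [inner_sub_left]
  linarith

/-- A gradient step is a contraction. -/
theorem IsStronglyConvex.norm_gradient_step_sq_le (hμ : 0 ≤ μ) (hL : 0 < L)
    (hg : IsSmooth L g) (hc : IsStronglyConvex μ g) {α : ℝ} (hα : 0 < α) (hαL : α * L ≤ 1 / 2)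
    (x y : Vec d) :
    ‖(x - y) - α • (gradient g x - gradient g y)‖ ^ 2
      ≤ (1 - 3 / 2 * (α * μ)) * ‖x - y‖ ^ 2 := by
  have h1 := hc.norm_gradient_sub_sq_le_inner hμ hL hg x y
  have h2 := hc.mul_norm_sq_le_inner x y
  rw [norm_sub_sq_real, inner_smul_right, norm_smul, Real.norm_of_nonneg hα.le,
    real_inner_comm, mul_pow]
  set I := inner ℝ (gradient g x - gradient g y) (x - y)
  have h0 : 0 ≤ I := le_trans (by positivity) h2
  -- Since `αL ≤ 1/2`, the quadratic term uses up a quarter of the linear gain `2αI`. The remaining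
  -- `3/2` exceeds `1`, which later separates the rate of the total energy from `1 - αμ`.
  have h3 : α ^ 2 * ‖gradient g x - gradient g y‖ ^ 2 ≤ α * (1 / 2) * I := by
    calc α ^ 2 * ‖gradient g x - gradient g y‖ ^ 2 ≤ α ^ 2 * (L * I) := by gcongr
      _ = α * (α * L) * I := by ring
      _ ≤ α * (1 / 2) * I := by gcongr
  have h4 : α * (μ * ‖x - y‖ ^ 2) ≤ α * I := by gcongr
  linarith

/-- The inexact descent step of the averaged iterate. -/
theorem inner_gradient_ge (hg : IsSmooth L g) (hc : IsStronglyConvex μ g) (x y z : Vec d) :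
    g y - g z + μ / 2 * ‖x - z‖ ^ 2 - L / 2 * ‖y - x‖ ^ 2
      ≤ inner ℝ (gradient g x) (y - z) := by
  have h1 := hc x z
  have h2 := hg.le_add_inner x y
  have h3 : y - z = (x - z) + (y - x) := by abel
  rw [h3, inner_add_right]
  linarith

end Convexity

-- Averages over the nodes and the inexact gradient step of the mean

section Averages

variable {n d : ℕ}

theorem nodeMean_sub (X Y : Stack n d) : nodeMean (X - Y) = nodeMean X - nodeMean Y := by
  simp [nodeMean, Finset.sum_sub_distrib, smul_sub]

theorem nodeMean_smul (c : ℝ) (X : Stack n d) : nodeMean (c • X) = c • nodeMean X := by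
  simp only [nodeMean, Pi.smul_apply, ← Finset.smul_sum]
  rw [smul_comm]

theorem nodeMean_const (hn : 0 < n) (x : Vec d) : nodeMean (fun _ : Fin n => x) = x := by
  have : (n : ℝ) ≠ 0 := by positivity
  simp only [nodeMean, Finset.sum_const, Finset.card_univ, Fintype.card_fin]
  rw [← Nat.cast_smul_eq_nsmul ℝ, smul_smul, one_div, inv_mul_cancel₀ this, one_smul]

theorem natCast_smul_nodeMean (hn : 0 < n) (X : Stack n d) :
    (n : ℝ) • nodeMean X = ∑ i, X i := by
  have : (n : ℝ) ≠ 0 := by positivity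
  rw [nodeMean, smul_smul, mul_one_div, div_self this, one_smul]

theorem sum_norm_sub_sq (hn : 0 < n) (X : Stack n d) (z : Vec d) :
    ∑ i, ‖X i - z‖ ^ 2 = ∑ i, ‖X i - nodeMean X‖ ^ 2 + n * ‖nodeMean X - z‖ ^ 2 := by
  have h : ∀ i, ‖X i - z‖ ^ 2 = ‖X i - nodeMean X‖ ^ 2
      + 2 * inner ℝ (X i - nodeMean X) (nodeMean X - z) + ‖nodeMean X - z‖ ^ 2 := by
    intro i
    rw [← norm_add_sq_real]; congr 2; abel
  have h0 : ∑ i, (X i - nodeMean X) = 0 := by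
    rw [Finset.sum_sub_distrib, ← natCast_smul_nodeMean hn]
    simp [Nat.cast_smul_eq_nsmul]
  simp only [h, Finset.sum_add_distrib, ← Finset.mul_sum, ← sum_inner, h0, inner_zero_left]
  simp

theorem norm_nodeMean_sq_le (hn : 0 < n) (X : Stack n d) :
    n * ‖nodeMean X‖ ^ 2 ≤ ∑ i, ‖X i‖ ^ 2 := by
  have h := sum_norm_sub_sq hn X 0
  simp only [sub_zero] at h
  have : 0 ≤ ∑ i, ‖X i - nodeMean X‖ ^ 2 := by positivity
  linarith

variable {f : Fin n → Vec d → ℝ} {L μ : ℝ}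

theorem sum_gradient_eq_zero (hn : 0 < n) (hf : ∀ i, Differentiable ℝ (f i)) {xstar : Vec d}
    (hmin : ∀ x, globalLoss f xstar ≤ globalLoss f x) : ∑ i, gradient (f i) xstar = 0 := by
  have h1 : HasFDerivAt (fun x => ∑ i, f i x) (∑ i, fderiv ℝ (f i) xstar) xstar :=
    HasFDerivAt.fun_sum fun i _ => (hf i xstar).hasFDerivAt
  have h2 : IsLocalMin (fun x => ∑ i, f i x) xstar := by
    refine Filter.Eventually.of_forall fun x => ?_
    have := hmin x
    simp only [globalLoss] at this
    exact le_of_mul_le_mul_left this (by positivity)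
  have h3 := h2.hasFDerivAt_eq_zero h1
  simp only [gradient, ← map_sum, h3, map_zero]

/-- One inexact gradient step on the average: the consensus error enters with the factor
`2αL`. -/
theorem norm_nodeMean_step_sq_le (hn : 0 < n) (hμ : 0 < μ) (hL : 0 < L)
    (hg : ∀ i, IsSmooth L (f i)) (hc : ∀ i, IsStronglyConvex μ (f i)) {xstar : Vec d}
    (hmin : ∀ x, globalLoss f xstar ≤ globalLoss f x) {α : ℝ} (hα : 0 < α)
    (hαL : α * L ≤ 1 / 2) (X : Stack n d) :
    ‖nodeMean X - xstar - α • nodeMean (fun i => gradient (f i) (X i))‖ ^ 2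
      ≤ (1 - α * μ) * ‖nodeMean X - xstar‖ ^ 2
        + 2 * α * L * ((1 / n) * ∑ i, ‖X i - nodeMean X‖ ^ 2) := by
  have hn' : (0 : ℝ) < n := by positivity
  set m := nodeMean X with hm
  set Φ := ∑ i, ‖X i - m‖ ^ 2 with hΦ
  have hΦ0 : 0 ≤ Φ := by positivity
  set Gm := nodeMean (fun i => gradient (f i) (X i)) with hGm
  set S := ∑ i, (f i m - f i xstar) with hS
  have hsum := natCast_smul_nodeMean hn (fun i => gradient (f i) (X i))
  rw [← hGm] at hsum
  have hz := sum_gradient_eq_zero hn (fun i => (hg i).1) hmin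
  -- the inner product
  have hinner : S + μ / 2 * (n * ‖m - xstar‖ ^ 2) - L / 2 * Φ ≤ n * inner ℝ Gm (m - xstar) := by
    have h1 : (n : ℝ) * inner ℝ Gm (m - xstar) = ∑ i, inner ℝ (gradient (f i) (X i)) (m - xstar) := by
      rw [← sum_inner, ← hsum, real_inner_smul_left]
    have h2 := Finset.sum_le_sum fun i (_ : i ∈ Finset.univ) =>
      inner_gradient_ge (hg i) (hc i) (X i) m xstar
    rw [← h1] at h2
    simp only [Finset.sum_sub_distrib, Finset.sum_add_distrib, ← Finset.mul_sum,
      norm_sub_rev m] at h2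
    rw [sum_norm_sub_sq hn X xstar, ← hm] at h2
    rw [hS, Finset.sum_sub_distrib]
    have : 0 ≤ μ / 2 * Φ := by positivity
    rw [← hΦ] at h2
    rw [mul_add] at h2
    linarith
  -- the squared gradient
  have hsq : n * ‖Gm‖ ^ 2 ≤ 2 * L ^ 2 * Φ + 4 * L * S := by
    have h1 : n • Gm = ∑ i, ((gradient (f i) (X i) - gradient (f i) m)
        + (gradient (f i) m - gradient (f i) xstar)) := by
      rw [← Nat.cast_smul_eq_nsmul ℝ, hsum]
      simp only [sub_add_sub_cancel, Finset.sum_sub_distrib, hz, sub_zero]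
    have h2 : Gm = nodeMean (fun i => (gradient (f i) (X i) - gradient (f i) m)
        + (gradient (f i) m - gradient (f i) xstar)) := by
      rw [nodeMean, ← h1, ← Nat.cast_smul_eq_nsmul ℝ, smul_smul, one_div,
        inv_mul_cancel₀ hn'.ne', one_smul]
    rw [h2]
    refine (norm_nodeMean_sq_le hn _).trans ?_
    have h3 : ∀ i, ‖(gradient (f i) (X i) - gradient (f i) m)
        + (gradient (f i) m - gradient (f i) xstar)‖ ^ 2
        ≤ 2 * L ^ 2 * ‖X i - m‖ ^ 2
          + 4 * L * (f i m - f i xstar - inner ℝ (gradient (f i) xstar) (m - xstar)) := by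
      intro i
      have a1 := pow_le_pow_left₀ (norm_nonneg _) ((hg i).2 (X i) m) 2
      have a2 := (hc i).norm_gradient_sub_sq_le hμ.le hL (hg i) xstar m
      have a3 := parallelogram_law_with_norm ℝ (gradient (f i) (X i) - gradient (f i) m)
        (gradient (f i) m - gradient (f i) xstar)
      have a4 := sq_nonneg ‖(gradient (f i) (X i) - gradient (f i) m)
        - (gradient (f i) m - gradient (f i) xstar)‖
      nlinarith
    refine (Finset.sum_le_sum fun i _ => h3 i).trans (le_of_eq ?_)
    simp only [Finset.sum_add_distrib, ← Finset.mul_sum]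
    rw [Finset.sum_sub_distrib (g := fun i => inner ℝ (gradient (f i) xstar) (m - xstar)),
      ← sum_inner, hz, inner_zero_left, sub_zero]
  have hS0 : 0 ≤ S := by
    have := hmin m
    simp only [globalLoss] at this
    have h := le_of_mul_le_mul_left this (by positivity)
    rw [hS, Finset.sum_sub_distrib]; linarith
  rw [norm_sub_sq_real, inner_smul_right, norm_smul, Real.norm_of_nonneg hα.le, mul_pow,
    real_inner_comm]
  refine le_of_mul_le_mul_left ?_ hn'
  have e : (n : ℝ) * ((1 - α * μ) * ‖m - xstar‖ ^ 2 + 2 * α * L * (1 / n * Φ))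
      = (1 - α * μ) * (n * ‖m - xstar‖ ^ 2) + 2 * α * L * Φ := by field_simp
  rw [e]
  have t1 := mul_le_mul_of_nonneg_left hinner (by positivity : 0 ≤ 2 * α)
  have t2 := mul_le_mul_of_nonneg_left hsq (by positivity : 0 ≤ α ^ 2)
  -- At `αL ≤ 1/2` the function gaps from the squared gradient are absorbed by `-2αS`, and the
  -- consensus terms `αLΦ + 2α²L²Φ` add up to at most `2αLΦ`.
  have t3 : α * (α * L) * (4 * S) ≤ α * (1 / 2) * (4 * S) := by gcongr
  have t4 : α * L * (α * L) * (2 * Φ) ≤ α * L * (1 / 2) * (2 * Φ) := by gcongr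
  linarith

end Averages

/-! ### Gossip operators on a Euclidean space -/

section Gossip

variable {K : Type*} [NormedAddCommGroup K] [InnerProductSpace ℝ K]

/-- `H` is a symmetric operator with `w P ≤ H ≤ c`, where `P` is an orthogonal projection with
`H P = P H = H`. -/
structure IsGossip (H P : K →ₗ[ℝ] K) (w c : ℝ) : Prop where
  gap_pos : 0 < w
  bound_pos : 0 < c
  symm : ∀ x y, inner ℝ (H x) y = inner ℝ x (H y)
  proj_symm : ∀ x y, inner ℝ (P x) y = inner ℝ x (P y)
  proj_proj : ∀ x, P (P x) = P x
  apply_proj : ∀ x, H (P x) = H x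
  proj_apply : ∀ x, P (H x) = H x
  gap : ∀ x, w * ‖P x‖ ^ 2 ≤ inner ℝ x (H x)
  bound : ∀ x, inner ℝ x (H x) ≤ c * ‖x‖ ^ 2

namespace IsGossip

variable {H P : K →ₗ[ℝ] K} {w c : ℝ} (h : IsGossip H P w c)
include h

theorem inner_nonneg (x : K) : 0 ≤ inner ℝ x (H x) :=
  le_trans (mul_nonneg h.gap_pos.le (sq_nonneg _)) (h.gap x)

theorem inner_proj (x y : K) : inner ℝ (P x) (P y) = inner ℝ x (P y) := by
  rw [h.proj_symm, h.proj_proj]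

theorem norm_proj_sq (x : K) : ‖P x‖ ^ 2 = inner ℝ x (P x) := by
  rw [← real_inner_self_eq_norm_sq, h.inner_proj]

theorem norm_sq_eq (x : K) : ‖x‖ ^ 2 = ‖P x‖ ^ 2 + ‖x - P x‖ ^ 2 := by
  rw [norm_sub_sq_real, h.norm_proj_sq]; ring

theorem norm_proj_sq_le (x : K) : ‖P x‖ ^ 2 ≤ ‖x‖ ^ 2 := by
  rw [h.norm_sq_eq x]
  have := sq_nonneg ‖x - P x‖
  linarith

/-- This is `H² ≤ c H`, obtained without spectral calculus: positivity of `H` at `x - H x / c`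
together with the upper bound at `H x`. -/
theorem norm_apply_sq_le (x : K) : ‖H x‖ ^ 2 ≤ c * inner ℝ x (H x) := by
  have h1 := h.inner_nonneg (x - (1 / c) • H x)
  have h2 := h.bound (H x)
  have hc := h.bound_pos
  simp only [map_sub, map_smul, inner_sub_left, inner_sub_right, real_inner_smul_left,
    inner_smul_right] at h1
  rw [← h.symm x (H x), real_inner_self_eq_norm_sq] at h1
  have h3 : 1 / c * (1 / c * inner ℝ (H x) (H (H x))) ≤ 1 / c * (1 / c * (c * ‖H x‖ ^ 2)) := by
    gcongr
  have h4 : 1 / c * (1 / c * (c * ‖H x‖ ^ 2)) = 1 / c * ‖H x‖ ^ 2 := by field_simp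
  have h5 : 1 / c * ‖H x‖ ^ 2 ≤ inner ℝ x (H x) := by linarith
  rw [div_mul_eq_mul_div, one_mul, div_le_iff₀ hc] at h5
  linarith

/-- This is `w H ≤ H²`, from expanding `‖w P x - H x‖² ≥ 0` and using the gap. -/
theorem gap_mul_inner_le (x : K) : w * inner ℝ x (H x) ≤ ‖H x‖ ^ 2 := by
  have hw := h.gap_pos
  have h1 : inner ℝ x (H x) = inner ℝ (P x) (H x) := by
    rw [h.proj_symm, h.proj_apply]
  have h2 := h.gap x
  have h3 := sq_nonneg ‖w • P x - H x‖
  rw [norm_sub_sq_real, norm_smul, Real.norm_of_nonneg hw.le, real_inner_smul_left, ← h1,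
    mul_pow] at h3
  have h4 : w ^ 2 * ‖P x‖ ^ 2 ≤ w * inner ℝ x (H x) := by
    rw [sq, mul_assoc]; gcongr
  linarith

/-- The operator `H + (I - P)` is positive definite, hence onto in finite dimension, and `P` maps
its values to those of `H`. This supplies the initial dual variable. -/
theorem exists_apply_eq [FiniteDimensional ℝ K] {y : K} (hy : P y = y) : ∃ s, H s = y := by
  let T : K →ₗ[ℝ] K := H + (LinearMap.id - P)
  have hT : ∀ x, T x = H x + (x - P x) := fun x => rfl
  have hinj : Function.Injective T := by
    rw [← LinearMap.ker_eq_bot, LinearMap.ker_eq_bot']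
    intro x hx
    have h1 : inner ℝ x (T x) = inner ℝ x (H x) + ‖x - P x‖ ^ 2 := by
      rw [hT, inner_add_right, norm_sub_sq_real, h.norm_proj_sq, inner_sub_right,
        real_inner_self_eq_norm_sq]
      ring
    rw [hx, inner_zero_right] at h1
    have h2 := h.gap x
    have hw := h.gap_pos
    have h3 : 0 ≤ w * ‖P x‖ ^ 2 := by positivity
    have h4 := sq_nonneg ‖x - P x‖
    have h5 : ‖x - P x‖ ^ 2 = 0 := by linarith
    have h6 : w * ‖P x‖ ^ 2 = 0 := by linarith
    have h7 : ‖P x‖ ^ 2 = 0 := by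
      rcases mul_eq_zero.1 h6 with h' | h'
      · exact absurd h' hw.ne'
      · exact h'
    have := h.norm_sq_eq x
    rw [h5, h7, add_zero] at this
    exact norm_eq_zero.1 (pow_eq_zero_iff two_ne_zero |>.1 this)
  obtain ⟨s, hs⟩ := LinearMap.injective_iff_surjective.1 hinj y
  refine ⟨s, ?_⟩
  have h1 : P (T s) = H s := by
    rw [hT, map_add, map_sub, h.proj_proj, h.proj_apply, sub_self, add_zero]
  rw [← h1, hs, hy]

end IsGossip

/-- The Lyapunov function `‖P x‖² + p⁻² ⟨s, H s⟩` of the consensus error. -/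
def lyapunov (H P : K →ₗ[ℝ] K) (p : ℝ) (x s : K) : ℝ :=
  ‖P x‖ ^ 2 + inner ℝ s (H s) / p ^ 2

/-- The mean over the coin of `lyapunov` after one iteration from the half step `z`. -/
def lyapunovNext (H P : K →ₗ[ℝ] K) (p : ℝ) (z s : K) : ℝ :=
  ‖P (z + H s)‖ ^ 2 - ‖H s‖ ^ 2 + inner ℝ s (H s) / p ^ 2 - p * (inner ℝ z (H z) - ‖H z‖ ^ 2)

/-- The coefficient of the noise in the linear part of `lyapunovNext`. -/
def lyapunovSlope (H P : K →ₗ[ℝ] K) (p : ℝ) (z s : K) : K :=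
  P (z + H s) - p • (H z - H (H z))

namespace IsGossip

variable {H P : K →ₗ[ℝ] K} {w c : ℝ} (h : IsGossip H P w c)
include h

theorem lyapunov_nonneg (p : ℝ) (x s : K) : 0 ≤ lyapunov H P p x s :=
  add_nonneg (sq_nonneg _) (div_nonneg (h.inner_nonneg s) (sq_nonneg p))

theorem norm_proj_sq_le_lyapunov (p : ℝ) (x s : K) : ‖P x‖ ^ 2 ≤ lyapunov H P p x s :=
  le_add_of_nonneg_right (div_nonneg (h.inner_nonneg s) (sq_nonneg p))

/-- The weight `p⁻²` on the dual part is what makes the cross terms combine to `2⟨z, H s⟩`,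
completing the square `‖P (z + H s)‖²`; one of the two copies of `p ⟨z, H z⟩` is cancelled and the
other remains as dissipation. -/
theorem lyapunov_mean_coin {p : ℝ} (hp : p ≠ 0) (z s : K) :
    p * lyapunov H P p (z - H z) (s + p • z) + (1 - p) * lyapunov H P p z s
      = lyapunovNext H P p z s := by
  have e1 : ‖P (z - H z)‖ ^ 2 = ‖P z‖ ^ 2 - 2 * inner ℝ z (H z) + ‖H z‖ ^ 2 := by
    rw [map_sub, h.proj_apply, norm_sub_sq_real, h.proj_symm, h.proj_apply]
  have e2 : inner ℝ (s + p • z) (H (s + p • z))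
      = inner ℝ s (H s) + 2 * p * inner ℝ z (H s) + p ^ 2 * inner ℝ z (H z) := by
    simp only [map_add, map_smul, inner_add_left, inner_add_right, real_inner_smul_left,
      inner_smul_right]
    rw [← h.symm s z, real_inner_comm z (H s)]
    ring
  have e3 : ‖P (z + H s)‖ ^ 2 = ‖P z‖ ^ 2 + 2 * inner ℝ z (H s) + ‖H s‖ ^ 2 := by
    rw [map_add, h.proj_apply, norm_add_sq_real, h.proj_symm, h.proj_apply]
  rw [lyapunov, lyapunov, lyapunovNext, e1, e2, e3]
  field_simp
  ring

/-- The left side is quadratic in `ν`. The linear part will have mean zero, and in the quadratic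
part the gossip contribution has a favourable sign because `H² ≤ H`. -/
theorem lyapunovNext_sub_le {p : ℝ} (hp : 0 ≤ p) (hc : c ≤ 1) (α : ℝ) (a s ν : K) :
    lyapunovNext H P p (a - α • ν) s
      ≤ lyapunovNext H P p a s - 2 * α * inner ℝ (lyapunovSlope H P p a s) ν
        + α ^ 2 * ‖P ν‖ ^ 2 := by
  have e1 : ‖P (a - α • ν + H s)‖ ^ 2
      = ‖P (a + H s)‖ ^ 2 - 2 * α * inner ℝ (P (a + H s)) ν + α ^ 2 * ‖P ν‖ ^ 2 := by
    have : P (a - α • ν + H s) = P (a + H s) - α • P ν := by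
      simp only [map_add, map_sub, map_smul]; abel
    rw [this, norm_sub_sq_real, inner_smul_right, h.inner_proj, norm_smul, mul_pow,
      Real.norm_eq_abs, sq_abs, ← h.proj_symm]
    ring
  have e2 : inner ℝ (a - α • ν) (H (a - α • ν))
      = inner ℝ a (H a) - 2 * α * inner ℝ (H a) ν + α ^ 2 * inner ℝ ν (H ν) := by
    simp only [map_sub, map_smul, inner_sub_left, inner_sub_right, real_inner_smul_left,
      inner_smul_right]
    rw [← h.symm a ν, real_inner_comm (H a) ν]
    ring
  have e3 : ‖H (a - α • ν)‖ ^ 2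
      = ‖H a‖ ^ 2 - 2 * α * inner ℝ (H (H a)) ν + α ^ 2 * ‖H ν‖ ^ 2 := by
    rw [map_sub, map_smul, norm_sub_sq_real, inner_smul_right, ← h.symm (H a), norm_smul, mul_pow,
      Real.norm_eq_abs, sq_abs]
    ring
  have h4 : ‖H ν‖ ^ 2 ≤ inner ℝ ν (H ν) :=
    (h.norm_apply_sq_le ν).trans (mul_le_of_le_one_left (h.inner_nonneg ν) hc)
  have h5 : 0 ≤ p * (α ^ 2 * (inner ℝ ν (H ν) - ‖H ν‖ ^ 2)) := by
    have := sub_nonneg.2 h4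
    positivity
  rw [lyapunovNext, lyapunovNext, lyapunovSlope, e1, e2, e3, inner_sub_left,
    real_inner_smul_left, inner_sub_left]
  linarith

/-- The dissipation is simply dropped; the dual contraction comes from `w H ≤ H²`. -/
theorem lyapunovNext_le {p : ℝ} (hp : 0 < p) (hc : c ≤ 1) (a s : K) :
    lyapunovNext H P p a s
      ≤ ‖P (a + H s)‖ ^ 2 + (1 - p ^ 2 * w) * (inner ℝ s (H s) / p ^ 2) := by
  have h1 := h.gap_mul_inner_le s
  have h4 : ‖H a‖ ^ 2 ≤ inner ℝ a (H a) :=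
    (h.norm_apply_sq_le a).trans (mul_le_of_le_one_left (h.inner_nonneg a) hc)
  have h5 : 0 ≤ p * (inner ℝ a (H a) - ‖H a‖ ^ 2) := mul_nonneg hp.le (sub_nonneg.2 h4)
  have h6 : p ^ 2 * w * (inner ℝ s (H s) / p ^ 2) = w * inner ℝ s (H s) := by field_simp
  rw [lyapunovNext, sub_mul, h6, one_mul]
  linarith

/-- The dissipation of the gossip step makes the consensus error contract on its own. -/
theorem lyapunovNext_le_contract {p : ℝ} (hp : 0 < p) (hp1 : p ≤ 1) (hc : c ≤ 1 / 18) (a s : K) :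
    lyapunovNext H P p a s
      ≤ (1 - 7 / 10 * (p * w)) * ‖P (a + H s)‖ ^ 2
        + (1 - 5 / 6 * (p ^ 2 * w)) * (inner ℝ s (H s) / p ^ 2) := by
  set x := a + H s with hx
  have ha : a = x - H s := by rw [hx]; abel
  have h1 := h.gap_mul_inner_le s
  have h2 : ‖H a‖ ^ 2 ≤ 1 / 18 * inner ℝ a (H a) :=
    (h.norm_apply_sq_le a).trans (mul_le_mul_of_nonneg_right hc (h.inner_nonneg a))
  have h3 : inner ℝ (H s) (H (H s)) ≤ 1 / 18 * ‖H s‖ ^ 2 :=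
    (h.bound (H s)).trans (mul_le_mul_of_nonneg_right hc (sq_nonneg _))
  -- Young's inequality in the seminorm of `H`: positivity of `H` at `x / 2 - 2 H s`.
  have h4 : 3 / 4 * inner ℝ x (H x) - 3 * inner ℝ (H s) (H (H s)) ≤ inner ℝ a (H a) := by
    have h5 := h.inner_nonneg ((1 / 2 : ℝ) • x - (2 : ℝ) • H s)
    rw [ha]
    simp only [map_sub, map_smul, inner_sub_left, inner_sub_right, real_inner_smul_left,
      inner_smul_right] at h5 ⊢
    linarith
  have h5 := h.gap x
  have h6 : p ^ 2 * w * (inner ℝ s (H s) / p ^ 2) = w * inner ℝ s (H s) := by field_simp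
  -- Here `17/18 · 3/4 ≥ 7/10`. The loss is at most `‖H s‖² / 6`, since `3c ≤ 1/6`, so `5/6` of the
  -- dual decrease is left.
  have hb : 17 / 18 * (3 / 4 * (w * ‖P x‖ ^ 2)) - 17 / 18 * (1 / 6 * ‖H s‖ ^ 2)
      ≤ inner ℝ a (H a) - ‖H a‖ ^ 2 := by linarith
  have h7 := mul_le_mul_of_nonneg_left hb hp.le
  have h8 : p * ‖H s‖ ^ 2 ≤ ‖H s‖ ^ 2 := mul_le_of_le_one_left (sq_nonneg _) hp1
  have hw := h.gap_pos
  have h9 : 0 ≤ p * w * ‖P x‖ ^ 2 := by positivity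
  have h10 := sq_nonneg ‖H s‖
  rw [lyapunovNext, ← hx, sub_mul, sub_mul, mul_assoc (5 / 6), h6]
  have h11 := h.inner_nonneg s
  have h12 : 0 ≤ w * inner ℝ s (H s) := by positivity
  linarith

end IsGossip

end Gossip

/-! ### Matrices acting on stacked variables -/

section StackOp

open Matrix

variable {n d : ℕ}

/-- Stacked variables with the Euclidean (Frobenius) norm. -/
abbrev NodeSpace (n d : ℕ) := PiLp 2 (fun _ : Fin n => Vec d)

/-- The action of an `n × n` matrix on stacked variables. -/
def stackOp (A : Matrix (Fin n) (Fin n) ℝ) : NodeSpace n d →ₗ[ℝ] NodeSpace n d where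
  toFun x := WithLp.toLp 2 (mix A x.ofLp)
  map_add' x y := by
    ext i : 1
    simp [mix, Finset.sum_add_distrib]
  map_smul' c x := by
    ext i : 1
    simp only [mix, PiLp.smul_apply, RingHom.id_apply, Finset.smul_sum]
    exact Finset.sum_congr rfl fun j _ => smul_comm _ _ _

theorem stackOp_apply (A : Matrix (Fin n) (Fin n) ℝ) (x : NodeSpace n d) (i : Fin n) :
    stackOp A x i = ∑ j, A i j • x j := rfl

theorem stackOp_mul (A B : Matrix (Fin n) (Fin n) ℝ) (x : NodeSpace n d) :
    stackOp A (stackOp B x) = stackOp (A * B) x := by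
  ext i : 1
  simp only [stackOp_apply, Matrix.mul_apply, Finset.sum_smul, Finset.smul_sum, smul_smul]
  exact Finset.sum_comm

theorem stackOp_one_sub (A : Matrix (Fin n) (Fin n) ℝ) (x : NodeSpace n d) :
    stackOp (1 - A) x = x - stackOp A x := by
  ext i : 1
  simp only [stackOp_apply, PiLp.sub_apply, Matrix.sub_apply, sub_smul, Finset.sum_sub_distrib]
  congr 1
  simp [Matrix.one_apply]

/-- A matrix acts on each of the `d` coordinates separately, so spectral bounds on `ℝⁿ` carry over
to stacked variables. -/
theorem inner_stackOp (A : Matrix (Fin n) (Fin n) ℝ) (x y : NodeSpace n d) :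
    inner ℝ x (stackOp A y) = ∑ k, (fun i => x i k) ⬝ᵥ A *ᵥ (fun j => y j k) := by
  have h : ∀ i, inner ℝ (x i) (stackOp A y i) = ∑ k, x i k * ∑ j, A i j * y j k := by
    intro i
    rw [PiLp.inner_apply]
    refine Finset.sum_congr rfl fun k _ => ?_
    rw [stackOp_apply]
    simp [mul_comm]
  rw [PiLp.inner_apply]
  simp only [h]
  rw [Finset.sum_comm]
  rfl

theorem inner_eq_sum_dotProduct (x y : NodeSpace n d) :
    inner ℝ x y = ∑ k, (fun i => x i k) ⬝ᵥ (fun j => y j k) := by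
  have h := inner_stackOp 1 x y
  simp only [one_mulVec] at h
  rw [← h]
  congr 1
  ext i : 1
  simp [stackOp_apply, Matrix.one_apply]

theorem inner_stackOp_left {A : Matrix (Fin n) (Fin n) ℝ} (hA : A.IsSymm) (x y : NodeSpace n d) :
    inner ℝ (stackOp A x) y = inner ℝ x (stackOp A y) := by
  rw [real_inner_comm, inner_stackOp, inner_stackOp]
  refine Finset.sum_congr rfl fun k _ => ?_
  rw [dotProduct_mulVec, ← mulVec_transpose, hA, dotProduct_comm]

/-- The averaging matrix. -/
def avgMatrix (n : ℕ) : Matrix (Fin n) (Fin n) ℝ := Matrix.of fun _ _ => 1 / (n : ℝ)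

theorem stackOp_avgMatrix (x : NodeSpace n d) (i : Fin n) :
    stackOp (avgMatrix n) x i = nodeMean x.ofLp := by
  rw [stackOp_apply, nodeMean, Finset.smul_sum]
  rfl

theorem avgMatrix_isSymm : (avgMatrix n).IsSymm := rfl

theorem avgMatrix_mul_self (hn : 0 < n) : avgMatrix n * avgMatrix n = avgMatrix n := by
  have : (n : ℝ) ≠ 0 := by positivity
  ext i j
  simp [Matrix.mul_apply, avgMatrix]
  field_simp

variable {W : Matrix (Fin n) (Fin n) ℝ} {χ : ℝ}

theorem one_sub_mixingA : 1 - mixingA χ W = (1 / (2 * χ)) • (1 - W) := by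
  rw [mixingA, sub_sub_cancel]

theorem IsMixingMatrix.mul_avgMatrix (hW : IsMixingMatrix W) : W * avgMatrix n = avgMatrix n := by
  ext i j
  simp only [Matrix.mul_apply, avgMatrix, Matrix.of_apply]
  rw [← Finset.sum_mul, sum_row_of_mem_doublyStochastic hW.stochastic, one_mul]

theorem IsMixingMatrix.avgMatrix_mul (hW : IsMixingMatrix W) : avgMatrix n * W = avgMatrix n := by
  ext i j
  simp only [Matrix.mul_apply, avgMatrix, Matrix.of_apply]
  rw [← Finset.mul_sum, sum_col_of_mem_doublyStochastic hW.stochastic, mul_one]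

/-- The gossip operator `I - W_a` of ProxSkip. -/
def gossipOp (W : Matrix (Fin n) (Fin n) ℝ) (χ : ℝ) (d : ℕ) : NodeSpace n d →ₗ[ℝ] NodeSpace n d :=
  stackOp (1 - mixingA χ W)

/-- The projection on the stacked variables with mean zero. -/
def centerOp (n d : ℕ) : NodeSpace n d →ₗ[ℝ] NodeSpace n d := stackOp (1 - avgMatrix n)

theorem centerOp_apply (x : NodeSpace n d) (i : Fin n) :
    centerOp n d x i = x i - nodeMean x.ofLp := by
  rw [centerOp, stackOp_one_sub, PiLp.sub_apply, stackOp_avgMatrix]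

theorem norm_centerOp_sq (x : NodeSpace n d) :
    ‖centerOp n d x‖ ^ 2 = ∑ i, ‖x i - nodeMean x.ofLp‖ ^ 2 := by
  rw [PiLp.norm_sq_eq_of_L2]
  simp only [centerOp_apply]

theorem mix_mixingA (Z : Stack n d) :
    mix (mixingA χ W) Z = Z - (gossipOp W χ d (WithLp.toLp 2 Z)).ofLp := by
  rw [gossipOp, stackOp_one_sub]
  simp only [WithLp.ofLp_sub, sub_sub_cancel]
  rfl

theorem inner_gossipOp (x : NodeSpace n d) :
    inner ℝ x (gossipOp W χ d x)
      = (1 / (2 * χ)) * (inner ℝ x x - ∑ k, (fun i => x i k) ⬝ᵥ W *ᵥ (fun j => x j k)) := by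
  rw [gossipOp, one_sub_mixingA, inner_stackOp, inner_eq_sum_dotProduct, ← Finset.sum_sub_distrib,
    Finset.mul_sum]
  refine Finset.sum_congr rfl fun k _ => ?_
  rw [smul_mulVec, dotProduct_smul, sub_mulVec, one_mulVec, dotProduct_sub, smul_eq_mul]

/-- The lower constant is the spectral gap on the vectors of mean zero; the upper one is `2 / (2χ)`,
from `W ≥ -I`. -/
theorem IsMixingMatrix.isGossip (hW : IsMixingMatrix W) (hn : 2 ≤ n) (hχ : 0 < χ) (d : ℕ) :
    IsGossip (gossipOp W χ d) (centerOp n d) ((1 - hW.lambda2 hn) / (2 * χ)) (1 / χ) := by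
  have hn0 : 0 < n := by omega
  have hs : (1 - mixingA χ W).IsSymm := by
    rw [one_sub_mixingA]
    exact (Matrix.isSymm_one.sub hW.symm).smul _
  have hP : (1 - avgMatrix n).IsSymm := Matrix.isSymm_one.sub avgMatrix_isSymm
  have hl := hW.lambda2_lt_one hn
  have hgap0 : 0 < (1 - hW.lambda2 hn) / (2 * χ) := div_pos (by linarith) (by positivity)
  have happly : ∀ x, gossipOp W χ d (centerOp n d x) = gossipOp W χ d x := by
    intro x
    rw [gossipOp, centerOp, stackOp_mul, mul_sub, mul_one, one_sub_mixingA, Matrix.smul_mul,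
      sub_mul, hW.mul_avgMatrix, one_mul, sub_self, smul_zero, sub_zero]
  have hproj : ∀ x y, inner ℝ (centerOp n d x) y = inner ℝ x (centerOp n d y) :=
    inner_stackOp_left hP
  have hsymm : ∀ x y, inner ℝ (gossipOp W χ d x) y = inner ℝ x (gossipOp W χ d y) :=
    inner_stackOp_left hs
  have hproj' : ∀ x, centerOp n d (gossipOp W χ d x) = gossipOp W χ d x := by
    intro x
    rw [gossipOp, centerOp, stackOp_mul, sub_mul, one_mul, one_sub_mixingA, Matrix.mul_smul,
      mul_sub, hW.avgMatrix_mul, mul_one, sub_self, smul_zero, sub_zero]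
  refine ⟨hgap0, by positivity, hsymm, hproj, ?_, happly, hproj', ?_, ?_⟩
  · intro x
    rw [centerOp, stackOp_mul, sub_mul, one_mul, mul_sub, mul_one, avgMatrix_mul_self hn0,
      sub_self, sub_zero]
  · intro x
    have h1 : inner ℝ x (gossipOp W χ d x)
        = inner ℝ (centerOp n d x) (gossipOp W χ d (centerOp n d x)) := by
      rw [happly, hproj, hproj']
    rw [h1, inner_gossipOp, ← real_inner_self_eq_norm_sq, div_mul_eq_mul_div, div_eq_mul_one_div,
      mul_comm]
    refine mul_le_mul_of_nonneg_left ?_ (by positivity)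
    have h2 : ∑ k, (fun i => centerOp n d x i k) ⬝ᵥ W *ᵥ (fun j => centerOp n d x j k)
        ≤ hW.lambda2 hn * inner ℝ (centerOp n d x) (centerOp n d x) := by
      rw [inner_eq_sum_dotProduct, Finset.mul_sum]
      refine Finset.sum_le_sum fun k _ => hW.dotProduct_mulVec_le_lambda2 hn ?_
      have h3 : ∑ i, centerOp n d x i = 0 := by
        simp only [centerOp_apply, Finset.sum_sub_distrib]
        rw [← natCast_smul_nodeMean hn0 x.ofLp]
        simp [Nat.cast_smul_eq_nsmul]
      have h4 := congrArg (fun v : Vec d => v k) h3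
      simpa using h4
    linarith
  · intro x
    have h2 : -inner ℝ x x ≤ ∑ k, (fun i => x i k) ⬝ᵥ W *ᵥ (fun j => x j k) := by
      rw [inner_eq_sum_dotProduct, ← Finset.sum_neg_distrib]
      exact Finset.sum_le_sum fun k _ => neg_le_dotProduct_mulVec hW.stochastic _
    rw [inner_gossipOp, ← real_inner_self_eq_norm_sq]
    calc _ ≤ 1 / (2 * χ) * (2 * inner ℝ x x) :=
          mul_le_mul_of_nonneg_left (by linarith) (by positivity)
      _ = _ := by field_simp

end StackOp

/-! ### Expectations with respect to independent samples and coins -/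

section Probability

theorem integrable_inner_of_memLp {Ω E : Type*} [MeasurableSpace Ω] {P : Measure Ω}
    [NormedAddCommGroup E] [InnerProductSpace ℝ E] {a b : Ω → E} (ha : MemLp a 2 P)
    (hb : MemLp b 2 P) : Integrable (fun ω => inner ℝ (a ω) (b ω)) P := by
  refine (ha.norm.integrable_mul hb.norm).mono (ha.1.inner hb.1) (ae_of_all _ fun ω => ?_)
  rw [Pi.mul_apply, norm_mul, norm_norm, norm_norm]
  exact norm_inner_le_norm _ _

theorem _root_.MeasureTheory.MemLp.linearMap_comp {Ω E F : Type*} [MeasurableSpace Ω]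
    {P : Measure Ω} [NormedAddCommGroup E] [NormedSpace ℝ E] [FiniteDimensional ℝ E]
    [NormedAddCommGroup F] [NormedSpace ℝ F] {a : Ω → E} (ha : MemLp a 2 P) (T : E →ₗ[ℝ] F) :
    MemLp (fun ω => T (a ω)) 2 P :=
  (LinearMap.toContinuousLinearMap T).comp_memLp' ha

variable {Ω : Type v} {m mΩ : MeasurableSpace Ω} {P : Measure Ω}

/-- A fresh sample `s` gives a noise that is orthogonal to everything that is independent of `s`,
as soon as the noise has conditional mean zero given the argument of the stochastic map. -/
theorem integral_inner_noise_eq_zero [IsProbabilityMeasure P] {E : Type*}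
    [NormedAddCommGroup E] [InnerProductSpace ℝ E]
    [FiniteDimensional ℝ E] [MeasurableSpace E] [BorelSpace E] {S : Type u} [MeasurableSpace S]
    (hm : m ≤ mΩ) {s : Ω → S} (hs : Measurable s)
    (hind : Indep m (MeasurableSpace.comap s inferInstance) P) {A x : Ω → E}
    (hA : Measurable[m] A) (hx : Measurable[m] x) (hA2 : MemLp A 2 P)
    {Γ : E × S → E} (hΓ : Measurable Γ) {h : E → E} (hh : Measurable h)
    (hub : P[fun ω => Γ (x ω, s ω) | MeasurableSpace.comap x inferInstance]
      =ᵐ[P] fun ω => h (x ω))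
    (hint : Integrable (fun ω => Γ (x ω, s ω)) P)
    (hnoise : MemLp (fun ω => Γ (x ω, s ω) - h (x ω)) 2 P) :
    ∫ ω, inner ℝ (A ω) (Γ (x ω, s ω) - h (x ω)) ∂P = 0 := by
  have hxm : Measurable x := hx.mono hm le_rfl
  have hAm : Measurable A := hA.mono hm le_rfl
  let N : E × S → E := fun q => Γ q - h q.1
  have hN : Measurable N := hΓ.sub (hh.comp measurable_fst)
  have hindep : ∀ {β : Type _} [MeasurableSpace β] (y : Ω → β), Measurable[m] y →
      IndepFun y s P := fun y hy =>
    (IndepFun_iff_Indep _ _ _).2 (indep_of_indep_of_le_left hind hy.comap_le)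
  have hPs : IsProbabilityMeasure (P.map s) := Measure.isProbabilityMeasure_map hs.aemeasurable
  have hPx : IsProbabilityMeasure (P.map x) := Measure.isProbabilityMeasure_map hxm.aemeasurable
  have hlaw1 : P.map (fun ω => (x ω, s ω)) = (P.map x).prod (P.map s) :=
    (indepFun_iff_map_prod_eq_prod_map_map hxm.aemeasurable hs.aemeasurable).1 (hindep x hx)
  have hAx : Measurable fun ω => (A ω, x ω) := hAm.prodMk hxm
  have hPAx : IsProbabilityMeasure (P.map fun ω => (A ω, x ω)) :=
    Measure.isProbabilityMeasure_map hAx.aemeasurable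
  have hlaw2 : P.map (fun ω => ((A ω, x ω), s ω))
      = (P.map fun ω => (A ω, x ω)).prod (P.map s) :=
    (indepFun_iff_map_prod_eq_prod_map_map hAx.aemeasurable hs.aemeasurable).1
      (hindep (fun ω => (A ω, x ω)) (Measurable.prodMk hA hx))
  -- the conditional mean of the noise
  have hN1 : Integrable N ((P.map x).prod (P.map s)) := by
    rw [← hlaw1, integrable_map_measure hN.aestronglyMeasurable (hxm.prodMk hs).aemeasurable]
    exact hnoise.integrable (by norm_num)
  -- By independence, averaging over the fresh sample alone leaves a function of the current point.
  -- Unbiasedness given `x` makes its integral over every event `x ∈ B` vanish, so it is zero almost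
  -- everywhere.
  have hk : (fun y => ∫ t, N (y, t) ∂(P.map s)) =ᵐ[P.map x] 0 := by
    refine hN1.integral_prod_left.ae_eq_zero_of_forall_setIntegral_eq_zero fun B hB _ => ?_
    have h1 := setIntegral_prod (μ := P.map x) (ν := P.map s) N (s := B) (t := Set.univ)
      hN1.integrableOn
    simp only [Measure.restrict_univ] at h1
    rw [← h1, ← hlaw1, setIntegral_map (hB.prod MeasurableSet.univ) hN.aestronglyMeasurable
      (hxm.prodMk hs).aemeasurable]
    have hpre : (fun ω => (x ω, s ω)) ⁻¹' (B ×ˢ Set.univ) = x ⁻¹' B := by ext ω; simp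
    rw [hpre]
    have hle : MeasurableSpace.comap x inferInstance ≤ mΩ := hxm.comap_le
    have h2 := setIntegral_condExp hle hint (s := x ⁻¹' B) ⟨B, hB, rfl⟩
    rw [setIntegral_congr_ae (g := fun ω => h (x ω)) (hxm hB)
      (hub.mono fun ω hω _ => hω)] at h2
    have hint2 : Integrable (fun ω => h (x ω)) P := integrable_condExp.congr hub
    change ∫ ω in x ⁻¹' B, (Γ (x ω, s ω) - h (x ω)) ∂P = 0
    rw [integral_sub hint.integrableOn hint2.integrableOn, h2, sub_self]
  -- The null set concerns `x` alone, so it remains null for the joint law with `A`. This upgrades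
  -- unbiasedness given `x` to orthogonality to the whole past.
  have hk2 : ∀ᵐ q ∂(P.map fun ω => (A ω, x ω)), ∫ t, N (q.2, t) ∂(P.map s) = 0 := by
    have hmap : (P.map fun ω => (A ω, x ω)).map Prod.snd = P.map x := by
      rw [Measure.map_map measurable_snd hAx]; rfl
    rw [← hmap] at hk
    exact ae_of_ae_map measurable_snd.aemeasurable hk
  let N2 : (E × E) × S → ℝ := fun q => inner ℝ q.1.1 (N (q.1.2, q.2))
  have hNq : Measurable fun q : (E × E) × S => N (q.1.2, q.2) :=
    hN.comp (measurable_fst.snd.prodMk measurable_snd)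
  have hN2 : Measurable N2 := measurable_fst.fst.inner hNq
  have hi2 : Integrable N2 ((P.map fun ω => (A ω, x ω)).prod (P.map s)) := by
    rw [← hlaw2, integrable_map_measure hN2.aestronglyMeasurable (hAx.prodMk hs).aemeasurable]
    exact integrable_inner_of_memLp hA2 hnoise
  have hi3 : Integrable (fun q : (E × E) × S => N (q.1.2, q.2))
      ((P.map fun ω => (A ω, x ω)).prod (P.map s)) := by
    rw [← hlaw2, integrable_map_measure hNq.aestronglyMeasurable (hAx.prodMk hs).aemeasurable]
    exact hnoise.integrable (by norm_num)
  calc ∫ ω, inner ℝ (A ω) (Γ (x ω, s ω) - h (x ω)) ∂P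
      = ∫ q, N2 q ∂(P.map fun ω => ((A ω, x ω), s ω)) :=
        (integral_map (hAx.prodMk hs).aemeasurable hN2.aestronglyMeasurable).symm
    _ = ∫ q, ∫ t, N2 (q, t) ∂(P.map s) ∂(P.map fun ω => (A ω, x ω)) := by
        rw [hlaw2, integral_prod _ hi2]
    _ = 0 := by
        refine integral_eq_zero_of_ae ?_
        filter_upwards [hk2, hi3.prod_right_ae] with q hq hq3
        change ∫ t, inner ℝ q.1 (N (q.2, t)) ∂(P.map s) = 0
        rw [integral_inner hq3, hq, inner_zero_right]

/-- The mean over an independent coin. -/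
theorem integral_coin {θ : Ω → Bool} (hθ : Measurable θ)
    (hind : Indep m (MeasurableSpace.comap θ inferInstance) P) {p : ℝ} (hp : 0 ≤ p)
    (hlaw : P {ω | θ ω = true} = ENNReal.ofReal p) {A B : Ω → ℝ}
    (hA : Measurable[m] A) (hB : Measurable[m] B) (hAi : Integrable A P) (hBi : Integrable B P) :
    ∫ ω, (if θ ω then A ω else B ω) ∂P = p * ∫ ω, A ω ∂P + (1 - p) * ∫ ω, B ω ∂P := by
  let r : Ω → ℝ := fun ω => if θ ω then 1 else 0
  have hr : Measurable r := (Measurable.of_discrete (f := fun b : Bool => if b then (1:ℝ) else 0)).comp hθ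
  have hrθ : MeasurableSpace.comap r inferInstance ≤ MeasurableSpace.comap θ inferInstance := by
    change MeasurableSpace.comap ((fun b : Bool => if b then (1:ℝ) else 0) ∘ θ) _ ≤ _
    rw [← MeasurableSpace.comap_comp]
    exact MeasurableSpace.comap_mono Measurable.of_discrete.comap_le
  have hindep : ∀ y : Ω → ℝ, Measurable[m] y → IndepFun r y P := fun y hy =>
    ((IndepFun_iff_Indep _ _ _).2 (indep_of_indep_of_le_right
      (indep_of_indep_of_le_left hind hy.comap_le) hrθ)).symm
  have hAr := (hindep A hA).integral_fun_mul_eq_mul_integral hr.aestronglyMeasurable hAi.1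
  have hBr := (hindep B hB).integral_fun_mul_eq_mul_integral hr.aestronglyMeasurable hBi.1
  have hset : MeasurableSet {ω | θ ω = true} := hθ (measurableSet_singleton true)
  have hir : ∫ ω, r ω ∂P = p := by
    have : r = Set.indicator {ω | θ ω = true} 1 := by
      ext ω; simp [r, Set.indicator_apply]
    rw [this, integral_indicator_one hset, Measure.real, hlaw, ENNReal.toReal_ofReal hp]
  rw [hir] at hAr hBr
  have hri : ∀ y : Ω → ℝ, Integrable y P → Integrable (fun ω => r ω * y ω) P := by
    intro y hy
    refine hy.mono (hr.aestronglyMeasurable.mul hy.1) (ae_of_all _ fun ω => ?_)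
    by_cases hω : θ ω = true <;> simp [r, hω]
  have heq : ∀ ω, (if θ ω then A ω else B ω) = r ω * A ω + (B ω - r ω * B ω) := by
    intro ω
    by_cases hω : θ ω = true <;> simp [r, hω]
  have hBs : Integrable (fun ω => B ω - r ω * B ω) P := hBi.sub (hri B hBi)
  simp only [heq]
  rw [integral_add (hri A hAi) hBs, integral_sub hBi (hri B hBi), hAr, hBr]
  ring

end Probability

/-! ### Real sequences -/

/-- A contraction driven by a geometrically decaying input with a noise floor. -/
theorem le_geometric_add_of_le {a b : ℕ → ℝ} {ρ ρ' s c K N d : ℝ} (hρ : 0 ≤ ρ) (hρ1 : ρ < 1)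
    (hρ' : ρ ≤ ρ') (hs : 0 ≤ s) (hsρ : s < ρ') (hc : 0 ≤ c) (hK : 0 ≤ K) (hN : 0 ≤ N) (hd : 0 ≤ d)
    (ha0 : 0 ≤ a 0) (hb : ∀ t, b t ≤ K * s ^ t + N) (ha : ∀ t, a (t + 1) ≤ ρ * a t + c * b t + d)
    (t : ℕ) : a t ≤ (a 0 + c * K / (ρ' - s)) * ρ' ^ t + (c * N + d) / (1 - ρ) := by
  have hgap : 0 < ρ' - s := by linarith
  set κ := c * K / (ρ' - s) with hκ
  have hκ0 : 0 ≤ κ := by positivity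
  set M := (c * N + d) / (1 - ρ) with hM
  have h1ρ : 0 < 1 - ρ := by linarith
  have hM0 : 0 ≤ M := by positivity
  have hM1 : ρ * M + (c * N + d) = M := by rw [hM]; field_simp; ring
  have hκ1 : κ * ρ' = κ * s + c * K := by
    have : κ * (ρ' - s) = c * K := by rw [hκ]; field_simp
    linarith
  -- The induction needs the extra term `-κ s ^ t`: by the choice of `κ`, its change in one step
  -- absorbs the input `c K s ^ t`.
  have hclaim : ∀ t, a t ≤ (a 0 + κ) * ρ' ^ t - κ * s ^ t + M := by
    intro t
    induction t with
    | zero => simp; exact hM0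
    | succ t ih =>
      have h1 : κ * s ^ t ≤ κ * ρ' ^ t := by gcongr
      have h2 : 0 ≤ (a 0 + κ) * ρ' ^ t - κ * s ^ t := by
        have : 0 ≤ a 0 * ρ' ^ t := mul_nonneg ha0 (pow_nonneg (hρ.trans hρ') t)
        linarith
      have h3 := mul_le_mul_of_nonneg_left ih hρ
      have h4 := mul_le_mul_of_nonneg_right hρ' h2
      have h5 := mul_le_mul_of_nonneg_left (hb t) hc
      have h6 : κ * ρ' * s ^ t = κ * s * s ^ t + c * K * s ^ t := by rw [hκ1]; ring
      rw [pow_succ, pow_succ]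
      have h7 := ha t
      linarith
  have : 0 ≤ κ * s ^ t := by positivity
  linarith [hclaim t]

/-! ### The one-step recursions -/

section Run

theorem _root_.MeasureTheory.MemLp.integrable_norm_sq {Ω E : Type*} [MeasurableSpace Ω]
    {P : Measure Ω} [NormedAddCommGroup E] {x : Ω → E} (hx : MemLp x 2 P) :
    Integrable (fun ω => ‖x ω‖ ^ 2) P := hx.integrable_norm_pow (by norm_num)

variable {K : Type*} [NormedAddCommGroup K] [InnerProductSpace ℝ K] [FiniteDimensional ℝ K]
  [MeasurableSpace K] [BorelSpace K] {Ω : Type v} {mΩ : MeasurableSpace Ω}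

/-- A run of ProxSkip in coordinates centered at the optimum: `x` is the primal error, `H s` the
dual error, `γ` the error of the exact gradients and `ν` the noise of the stochastic gradients.
The σ-algebra `m t` is the past of iteration `t`, and `m' t` also contains the noise. -/
structure IsRun (H Q : K →ₗ[ℝ] K) (α p L μ : ℝ) (P : Measure Ω) (m m' : ℕ → MeasurableSpace Ω)
    (x s γ ν : ℕ → Ω → K) (θ : ℕ → Ω → Bool) : Prop where
  past_le : ∀ t, m t ≤ m' t
  le : ∀ t, m' t ≤ mΩ
  measurable_x : ∀ t, Measurable[m t] (x t)
  measurable_s : ∀ t, Measurable[m t] (s t)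
  measurable_grad : ∀ t, Measurable[m t] (γ t)
  measurable_noise : ∀ t, Measurable[m' t] (ν t)
  memLp_x : ∀ t, MemLp (x t) 2 P
  memLp_s : ∀ t, MemLp (s t) 2 P
  memLp_grad : ∀ t, MemLp (γ t) 2 P
  memLp_noise : ∀ t, MemLp (ν t) 2 P
  orthogonal : ∀ t (A : Ω → K), Measurable[m t] A → MemLp A 2 P →
    ∫ ω, inner ℝ (A ω) (ν t ω) ∂P = 0
  measurable_coin : ∀ t, Measurable (θ t)
  indep_coin : ∀ t, Indep (m' t) (MeasurableSpace.comap (θ t) inferInstance) P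
  law_coin : ∀ t, P {ω | θ t ω = true} = ENNReal.ofReal p
  x_succ : ∀ t ω, x (t + 1) ω =
    (x t ω - α • γ t ω - H (s t ω) - α • ν t ω)
      - if θ t ω then H (x t ω - α • γ t ω - H (s t ω) - α • ν t ω) else 0
  s_succ : ∀ t ω, s (t + 1) ω =
    s t ω + if θ t ω then p • (x t ω - α • γ t ω - H (s t ω) - α • ν t ω) else 0
  norm_step : ∀ t ω, ‖x t ω - α • γ t ω‖ ^ 2 ≤ (1 - 3 / 2 * (α * μ)) * ‖x t ω‖ ^ 2
  norm_grad : ∀ t ω, ‖γ t ω‖ ≤ L * ‖x t ω‖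
  norm_mean_step : ∀ t ω,
    ‖x t ω - α • γ t ω - Q (x t ω - α • γ t ω)‖ ^ 2
      ≤ (1 - α * μ) * ‖x t ω - Q (x t ω)‖ ^ 2 + 2 * α * L * ‖Q (x t ω)‖ ^ 2

theorem measurable_linearMap (T : K →ₗ[ℝ] K) : Measurable T :=
  T.continuous_of_finiteDimensional.measurable

variable {H Q : K →ₗ[ℝ] K} {P : Measure Ω}

theorem measurable_lyapunov (p : ℝ) :
    Measurable fun q : K × K => lyapunov H Q p q.1 q.2 := by
  have hH := measurable_linearMap H
  have hQ := measurable_linearMap Q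
  unfold lyapunov
  fun_prop

omit [MeasurableSpace K] [BorelSpace K] in
theorem integrable_lyapunov (p : ℝ) {x s : Ω → K} (hx : MemLp x 2 P) (hs : MemLp s 2 P) :
    Integrable (fun ω => lyapunov H Q p (x ω) (s ω)) P :=
  (hx.linearMap_comp Q).integrable_norm_pow (by norm_num) |>.add
    ((integrable_inner_of_memLp hs (hs.linearMap_comp H)).div_const _)

omit [MeasurableSpace K] [BorelSpace K] in
theorem integrable_lyapunovNext (p : ℝ) {z s : Ω → K} (hz : MemLp z 2 P) (hs : MemLp s 2 P) :
    Integrable (fun ω => lyapunovNext H Q p (z ω) (s ω)) P :=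
  ((((hz.add (hs.linearMap_comp H)).linearMap_comp Q).integrable_norm_pow (by norm_num)).sub
    ((hs.linearMap_comp H).integrable_norm_pow (by norm_num)) |>.add
    ((integrable_inner_of_memLp hs (hs.linearMap_comp H)).div_const _)).sub
    (((integrable_inner_of_memLp hz (hz.linearMap_comp H)).sub
      ((hz.linearMap_comp H).integrable_norm_pow (by norm_num))).const_mul p)

namespace IsRun

variable {α p L μ w c : ℝ} {m m' : ℕ → MeasurableSpace Ω}
  {x s γ ν : ℕ → Ω → K} {θ : ℕ → Ω → Bool}
  (h : IsRun H Q α p L μ P m m' x s γ ν θ) (hG : IsGossip H Q w c)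
include h

omit [BorelSpace K] in
theorem memLp_center (t : ℕ) : MemLp (fun ω => x t ω - α • γ t ω - H (s t ω)) 2 P :=
  ((h.memLp_x t).sub ((h.memLp_grad t).const_smul α)).sub ((h.memLp_s t).linearMap_comp H)

theorem measurable_center (t : ℕ) : Measurable[m t] fun ω => x t ω - α • γ t ω - H (s t ω) :=
  ((h.measurable_x t).sub ((h.measurable_grad t).const_smul α)).sub
    ((measurable_linearMap H).comp (h.measurable_s t))

include hG

/-- The coin is averaged first, being independent of the past and of the current samples; the noise
is then orthogonal to the slope, which depends on the past only. -/
theorem integral_lyapunov_succ_le (hp : 0 < p) (hc : c ≤ 1) (t : ℕ) :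
    ∫ ω, lyapunov H Q p (x (t + 1) ω) (s (t + 1) ω) ∂P
      ≤ ∫ ω, lyapunovNext H Q p (x t ω - α • γ t ω - H (s t ω)) (s t ω) ∂P
        + α ^ 2 * ∫ ω, ‖Q (ν t ω)‖ ^ 2 ∂P := by
  set a : Ω → K := fun ω => x t ω - α • γ t ω - H (s t ω) with ha
  have ha2 : MemLp a 2 P := h.memLp_center t
  have ham : Measurable[m t] a := h.measurable_center t
  set z : Ω → K := fun ω => a ω - α • ν t ω with hz
  have hz2 : MemLp z 2 P := ha2.sub ((h.memLp_noise t).const_smul α)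
  have hs2 := h.memLp_s t
  have hzm : Measurable[m' t] z :=
    (ham.mono (h.past_le t) le_rfl).sub ((h.measurable_noise t).const_smul α)
  have hsm : Measurable[m' t] (s t) := (h.measurable_s t).mono (h.past_le t) le_rfl
  have hH := measurable_linearMap H
  have e1 : ∀ ω, lyapunov H Q p (x (t + 1) ω) (s (t + 1) ω)
      = if θ t ω then lyapunov H Q p (z ω - H (z ω)) (s t ω + p • z ω)
        else lyapunov H Q p (z ω) (s t ω) := by
    intro ω
    rw [h.x_succ, h.s_succ]
    by_cases hω : θ t ω = true <;> simp [hω, hz, ha]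
  have hz1 : MemLp (fun ω => z ω - H (z ω)) 2 P := hz2.sub (hz2.linearMap_comp H)
  have hs1 : MemLp (fun ω => s t ω + p • z ω) 2 P := hs2.add (hz2.const_smul p)
  have e2 := integral_coin (h.measurable_coin t) (h.indep_coin t) hp.le (h.law_coin t)
    (A := fun ω => lyapunov H Q p (z ω - H (z ω)) (s t ω + p • z ω))
    (B := fun ω => lyapunov H Q p (z ω) (s t ω))
    ((measurable_lyapunov p).comp ((hzm.sub (hH.comp hzm)).prodMk (hsm.add (hzm.const_smul p))))
    ((measurable_lyapunov p).comp (hzm.prodMk hsm))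
    (integrable_lyapunov p hz1 hs1) (integrable_lyapunov p hz2 hs2)
  have e3 : ∫ ω, lyapunov H Q p (x (t + 1) ω) (s (t + 1) ω) ∂P
      = ∫ ω, lyapunovNext H Q p (z ω) (s t ω) ∂P := by
    simp only [e1]
    rw [e2, ← integral_const_mul, ← integral_const_mul, ← integral_add
      ((integrable_lyapunov p hz1 hs1).const_mul p)
      ((integrable_lyapunov p hz2 hs2).const_mul (1 - p))]
    exact integral_congr_ae (ae_of_all _ fun ω => hG.lyapunov_mean_coin hp.ne' (z ω) (s t ω))
  let b : Ω → K := fun ω => lyapunovSlope H Q p (a ω) (s t ω)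
  have hbm : Measurable[m t] b := by
    have hQ := measurable_linearMap Q
    have hf : Measurable fun q : K × K => lyapunovSlope H Q p q.1 q.2 := by
      unfold lyapunovSlope
      fun_prop
    exact hf.comp (ham.prodMk (h.measurable_s t))
  have hb2 : MemLp b 2 P :=
    ((ha2.add (hs2.linearMap_comp H)).linearMap_comp Q).sub
      (((ha2.linearMap_comp H).sub ((ha2.linearMap_comp H).linearMap_comp H)).const_smul p)
  have horth := h.orthogonal t b hbm hb2
  have hi1 := integrable_lyapunovNext (H := H) (Q := Q) p ha2 hs2
  have hi2 := (integrable_inner_of_memLp hb2 (h.memLp_noise t)).const_mul (2 * α)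
  have hi3 := ((h.memLp_noise t).linearMap_comp Q).integrable_norm_sq.const_mul (α ^ 2)
  rw [e3]
  calc ∫ ω, lyapunovNext H Q p (z ω) (s t ω) ∂P
      ≤ ∫ ω, (lyapunovNext H Q p (a ω) (s t ω) - 2 * α * inner ℝ (b ω) (ν t ω)
          + α ^ 2 * ‖Q (ν t ω)‖ ^ 2) ∂P :=
        integral_mono (integrable_lyapunovNext p hz2 hs2) ((hi1.sub hi2).add hi3)
          fun ω => hG.lyapunovNext_sub_le hp.le hc α (a ω) (s t ω) (ν t ω)
    _ = _ := by
        have hi12 : Integrable (fun ω => lyapunovNext H Q p (a ω) (s t ω)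
            - 2 * α * inner ℝ (b ω) (ν t ω)) P := hi1.sub hi2
        rw [integral_add hi12 hi3, integral_sub hi1 hi2, integral_const_mul, integral_const_mul,
          horth, mul_zero, sub_zero]

/-- Everything in the range of `H` has mean zero, so neither the coin nor the dual variable acts on
the average. -/
theorem integral_mean_succ (t : ℕ) :
    ∫ ω, ‖x (t + 1) ω - Q (x (t + 1) ω)‖ ^ 2 ∂P
      = ∫ ω, ‖x t ω - α • γ t ω - Q (x t ω - α • γ t ω)‖ ^ 2 ∂P
        + α ^ 2 * ∫ ω, ‖ν t ω - Q (ν t ω)‖ ^ 2 ∂P := by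
  set y : Ω → K := fun ω => x t ω - α • γ t ω with hy
  have hy2 : MemLp y 2 P := (h.memLp_x t).sub ((h.memLp_grad t).const_smul α)
  have hym : Measurable[m t] y := (h.measurable_x t).sub ((h.measurable_grad t).const_smul α)
  let b : Ω → K := fun ω => y ω - Q (y ω)
  have hQ := measurable_linearMap Q
  have hbm : Measurable[m t] b := hym.sub (hQ.comp hym)
  have hb2 : MemLp b 2 P := hy2.sub (hy2.linearMap_comp Q)
  have hν2 := h.memLp_noise t
  have horth := h.orthogonal t b hbm hb2
  have e1 : ∀ ω, ‖x (t + 1) ω - Q (x (t + 1) ω)‖ ^ 2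
      = ‖b ω‖ ^ 2 - 2 * α * inner ℝ (b ω) (ν t ω) + α ^ 2 * ‖ν t ω - Q (ν t ω)‖ ^ 2 := by
    intro ω
    have h1 : x (t + 1) ω - Q (x (t + 1) ω) = b ω - α • (ν t ω - Q (ν t ω)) := by
      rw [h.x_succ]
      by_cases hω : θ t ω = true
      · simp only [hω, if_true, map_sub, map_smul, hG.proj_apply, b, hy, smul_sub]
        abel
      · simp only [hω, if_false, map_sub, map_smul, hG.proj_apply, b, hy, smul_sub, sub_zero,
          Bool.false_eq_true]
        abel
    have h2 : inner ℝ (b ω) (Q (ν t ω)) = 0 := by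
      rw [← hG.proj_symm, map_sub, hG.proj_proj, sub_self, inner_zero_left]
    rw [h1, norm_sub_sq_real, inner_smul_right, inner_sub_right, h2, norm_smul, mul_pow,
      Real.norm_eq_abs, sq_abs]
    ring
  have hi1 := hb2.integrable_norm_sq
  have hi2 := (integrable_inner_of_memLp hb2 hν2).const_mul (2 * α)
  have hν3 : MemLp (fun ω => ν t ω - Q (ν t ω)) 2 P := hν2.sub (hν2.linearMap_comp Q)
  have hi3 := hν3.integrable_norm_sq.const_mul (α ^ 2)
  have hi12 : Integrable (fun ω => ‖b ω‖ ^ 2 - 2 * α * inner ℝ (b ω) (ν t ω)) P := hi1.sub hi2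
  simp only [e1]
  rw [integral_add hi12 hi3, integral_sub hi1 hi2, integral_const_mul, integral_const_mul,
    horth, mul_zero, sub_zero]

/-- The squared distance of the averages to the optimum, scaled by the number of nodes. -/
theorem integral_mean_succ_le (hαL : 0 ≤ α * L) (t : ℕ) :
    ∫ ω, ‖x (t + 1) ω - Q (x (t + 1) ω)‖ ^ 2 ∂P
      ≤ (1 - α * μ) * ∫ ω, ‖x t ω - Q (x t ω)‖ ^ 2 ∂P
        + 2 * α * L * ∫ ω, lyapunov H Q p (x t ω) (s t ω) ∂P
        + α ^ 2 * ∫ ω, ‖ν t ω - Q (ν t ω)‖ ^ 2 ∂P := by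
  rw [h.integral_mean_succ hG t]
  gcongr
  have hx := h.memLp_x t
  have hxQ : MemLp (fun ω => x t ω - Q (x t ω)) 2 P := hx.sub (hx.linearMap_comp Q)
  have hy2 : MemLp (fun ω => x t ω - α • γ t ω) 2 P := hx.sub ((h.memLp_grad t).const_smul α)
  have hyQ : MemLp (fun ω => x t ω - α • γ t ω - Q (x t ω - α • γ t ω)) 2 P :=
    hy2.sub (hy2.linearMap_comp Q)
  have hl := integrable_lyapunov (H := H) (Q := Q) p hx (h.memLp_s t)
  rw [← integral_const_mul, ← integral_const_mul, ← integral_add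
    (hxQ.integrable_norm_sq.const_mul _) (hl.const_mul _)]
  refine integral_mono hyQ.integrable_norm_sq
    ((hxQ.integrable_norm_sq.const_mul _).add (hl.const_mul _)) fun ω => ?_
  refine (h.norm_mean_step t ω).trans ?_
  have h1 := mul_le_mul_of_nonneg_left (hG.norm_proj_sq_le_lyapunov p (x t ω) (s t ω))
    (by linarith : 0 ≤ 2 * (α * L))
  linarith

/-- By Pythagoras the average part and the consensus part of the gradient step add up to the full
gradient step, which contracts node by node. -/
theorem integral_total_succ_le (hp : 0 < p) (hc : c ≤ 1) {q : ℝ}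
    (hq1 : 1 - 3 / 2 * (α * μ) ≤ q) (hq2 : 1 - p ^ 2 * w ≤ q) (t : ℕ) :
    ∫ ω, ‖x (t + 1) ω - Q (x (t + 1) ω)‖ ^ 2 ∂P
        + ∫ ω, lyapunov H Q p (x (t + 1) ω) (s (t + 1) ω) ∂P
      ≤ q * (∫ ω, ‖x t ω - Q (x t ω)‖ ^ 2 ∂P + ∫ ω, lyapunov H Q p (x t ω) (s t ω) ∂P)
        + α ^ 2 * ∫ ω, ‖ν t ω‖ ^ 2 ∂P := by
  have hx := h.memLp_x t
  have hs := h.memLp_s t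
  have hν := h.memLp_noise t
  have hxQ : MemLp (fun ω => x t ω - Q (x t ω)) 2 P := hx.sub (hx.linearMap_comp Q)
  have hνQ : MemLp (fun ω => ν t ω - Q (ν t ω)) 2 P := hν.sub (hν.linearMap_comp Q)
  have hy2 : MemLp (fun ω => x t ω - α • γ t ω) 2 P := hx.sub ((h.memLp_grad t).const_smul α)
  have hyQ : MemLp (fun ω => x t ω - α • γ t ω - Q (x t ω - α • γ t ω)) 2 P :=
    hy2.sub (hy2.linearMap_comp Q)
  have hl := integrable_lyapunov (H := H) (Q := Q) p hx hs
  have hln := integrable_lyapunovNext (H := H) (Q := Q) p (h.memLp_center t) hs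
  have h1 := h.integral_lyapunov_succ_le hG hp hc t
  have h2 := h.integral_mean_succ hG t
  have h3 : ∫ ω, ‖ν t ω‖ ^ 2 ∂P
      = ∫ ω, ‖Q (ν t ω)‖ ^ 2 ∂P + ∫ ω, ‖ν t ω - Q (ν t ω)‖ ^ 2 ∂P := by
    rw [← integral_add (hν.linearMap_comp Q).integrable_norm_sq hνQ.integrable_norm_sq]
    exact integral_congr_ae (ae_of_all _ fun ω => hG.norm_sq_eq (ν t ω))
  have h4 : ∫ ω, ‖x t ω - α • γ t ω - Q (x t ω - α • γ t ω)‖ ^ 2 ∂P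
      + ∫ ω, lyapunovNext H Q p (x t ω - α • γ t ω - H (s t ω)) (s t ω) ∂P
      ≤ q * (∫ ω, ‖x t ω - Q (x t ω)‖ ^ 2 ∂P + ∫ ω, lyapunov H Q p (x t ω) (s t ω) ∂P) := by
    rw [← integral_add hyQ.integrable_norm_sq hln, ← integral_add hxQ.integrable_norm_sq hl,
      ← integral_const_mul]
    refine integral_mono (hyQ.integrable_norm_sq.add hln)
      ((hxQ.integrable_norm_sq.add hl).const_mul q) fun ω => ?_
    have a1 := hG.lyapunovNext_le hp hc (x t ω - α • γ t ω - H (s t ω)) (s t ω)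
    rw [sub_add_cancel] at a1
    have a2 := hG.norm_sq_eq (x t ω - α • γ t ω)
    have a3 := h.norm_step t ω
    have a4 := hG.norm_sq_eq (x t ω)
    have a5 := mul_le_mul_of_nonneg_right hq1 (sq_nonneg ‖x t ω‖)
    have a6 := mul_le_mul_of_nonneg_right hq2
      (div_nonneg (hG.inner_nonneg (s t ω)) (sq_nonneg p))
    simp only [lyapunov] at a1 ⊢
    rw [a4] at a3 a5
    linarith
  rw [h3]
  linarith

/-- Gradients of different functions do not commute with centring, so `αγ` is treated as a
perturbation and the contraction is drawn from the dissipation alone. -/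
theorem integral_lyapunov_contract (hp : 0 < p) (hp1 : p ≤ 1) (hc : c ≤ 1 / 18)
    (hpw : p * w ≤ 1) (t : ℕ) :
    ∫ ω, lyapunov H Q p (x (t + 1) ω) (s (t + 1) ω) ∂P
      ≤ (1 - 3 / 5 * (p ^ 2 * w)) * ∫ ω, lyapunov H Q p (x t ω) (s t ω) ∂P
        + (11 * α ^ 2 * L ^ 2 / (p * w))
          * (∫ ω, ‖x t ω - Q (x t ω)‖ ^ 2 ∂P + ∫ ω, lyapunov H Q p (x t ω) (s t ω) ∂P)
        + α ^ 2 * ∫ ω, ‖ν t ω‖ ^ 2 ∂P := by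
  have hw := hG.gap_pos
  have hx := h.memLp_x t
  have hs := h.memLp_s t
  have hν := h.memLp_noise t
  have hxQ : MemLp (fun ω => x t ω - Q (x t ω)) 2 P := hx.sub (hx.linearMap_comp Q)
  have hl := integrable_lyapunov (H := H) (Q := Q) p hx hs
  have hln := integrable_lyapunovNext (H := H) (Q := Q) p (h.memLp_center t) hs
  have h1 := h.integral_lyapunov_succ_le hG hp (hc.trans (by norm_num)) t
  have h2 : ∫ ω, ‖Q (ν t ω)‖ ^ 2 ∂P ≤ ∫ ω, ‖ν t ω‖ ^ 2 ∂P :=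
    integral_mono (hν.linearMap_comp Q).integrable_norm_sq hν.integrable_norm_sq
      fun ω => hG.norm_proj_sq_le (ν t ω)
  have h3 := mul_le_mul_of_nonneg_left h2 (sq_nonneg α)
  refine h1.trans ?_
  refine add_le_add ?_ h3
  have hia := hl.const_mul (1 - 3 / 5 * (p ^ 2 * w))
  have hib : Integrable (fun ω => 11 * α ^ 2 * L ^ 2 / (p * w)
      * (‖x t ω - Q (x t ω)‖ ^ 2 + lyapunov H Q p (x t ω) (s t ω))) P :=
    (hxQ.integrable_norm_sq.add hl).const_mul _
  rw [← integral_add hxQ.integrable_norm_sq hl, ← integral_const_mul, ← integral_const_mul,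
    ← integral_add hia hib]
  refine integral_mono hln (hia.add hib) fun ω => ?_
  have a1 := hG.lyapunovNext_le_contract hp hp1 hc (x t ω - α • γ t ω - H (s t ω)) (s t ω)
  rw [sub_add_cancel] at a1
  have hpw0 : 0 < p * w := by positivity
  -- Young's inequality with weight `p w / 10`
  have a2 : ‖Q (x t ω - α • γ t ω)‖ ^ 2
      ≤ (1 + p * w / 10) * ‖Q (x t ω)‖ ^ 2 + (1 + 10 / (p * w)) * (α ^ 2 * ‖γ t ω‖ ^ 2) := by
    have b1 : Q (x t ω - α • γ t ω) = Q (x t ω) - α • Q (γ t ω) := by simp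
    have b2 := sq_nonneg ‖(p * w / 10) • Q (x t ω) + α • Q (γ t ω)‖
    rw [norm_add_sq_real, norm_smul, norm_smul, real_inner_smul_left, mul_pow, mul_pow,
      Real.norm_eq_abs, Real.norm_eq_abs, sq_abs, sq_abs] at b2
    have b3 : 0 ≤ 10 / (p * w) * ((p * w / 10) ^ 2 * ‖Q (x t ω)‖ ^ 2
        + 2 * (p * w / 10 * inner ℝ (Q (x t ω)) (α • Q (γ t ω))) + α ^ 2 * ‖Q (γ t ω)‖ ^ 2) :=
      mul_nonneg (by positivity) b2
    have b4 : 10 / (p * w) * ((p * w / 10) ^ 2 * ‖Q (x t ω)‖ ^ 2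
        + 2 * (p * w / 10 * inner ℝ (Q (x t ω)) (α • Q (γ t ω))) + α ^ 2 * ‖Q (γ t ω)‖ ^ 2)
        = p * w / 10 * ‖Q (x t ω)‖ ^ 2 + 2 * inner ℝ (Q (x t ω)) (α • Q (γ t ω))
          + 10 / (p * w) * (α ^ 2 * ‖Q (γ t ω)‖ ^ 2) := by
      field_simp
    rw [b4] at b3
    have b5 : (1 + 10 / (p * w)) * (α ^ 2 * ‖Q (γ t ω)‖ ^ 2)
        ≤ (1 + 10 / (p * w)) * (α ^ 2 * ‖γ t ω‖ ^ 2) := by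
      have := hG.norm_proj_sq_le (γ t ω)
      gcongr
    rw [b1, norm_sub_sq_real, norm_smul, mul_pow, Real.norm_eq_abs, sq_abs]
    linarith
  have a3 : (1 + 10 / (p * w)) * (α ^ 2 * ‖γ t ω‖ ^ 2)
      ≤ 11 * α ^ 2 * L ^ 2 / (p * w) * ‖x t ω‖ ^ 2 := by
    have b1 := pow_le_pow_left₀ (norm_nonneg _) (h.norm_grad t ω) 2
    have b2 : 1 + 10 / (p * w) ≤ 11 / (p * w) := by
      have : 1 ≤ 1 / (p * w) := by rw [le_div_iff₀ hpw0]; linarith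
      have e : 11 / (p * w) = 1 / (p * w) + 10 / (p * w) := by ring
      rw [e]; linarith
    calc (1 + 10 / (p * w)) * (α ^ 2 * ‖γ t ω‖ ^ 2)
        ≤ 11 / (p * w) * (α ^ 2 * (L * ‖x t ω‖) ^ 2) := by gcongr
      _ = _ := by ring
  have a4 : ‖x t ω‖ ^ 2 ≤ ‖x t ω - Q (x t ω)‖ ^ 2 + lyapunov H Q p (x t ω) (s t ω) := by
    rw [hG.norm_sq_eq (x t ω)]
    have := hG.norm_proj_sq_le_lyapunov p (x t ω) (s t ω)
    linarith
  have a5 : 11 * α ^ 2 * L ^ 2 / (p * w) * ‖x t ω‖ ^ 2 ≤ 11 * α ^ 2 * L ^ 2 / (p * w)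
      * (‖x t ω - Q (x t ω)‖ ^ 2 + lyapunov H Q p (x t ω) (s t ω)) := by gcongr
  have a6 : (1 - 7 / 10 * (p * w)) * ‖Q (x t ω - α • γ t ω)‖ ^ 2
      ≤ (1 - 3 / 5 * (p ^ 2 * w)) * ‖Q (x t ω)‖ ^ 2
        + (1 + 10 / (p * w)) * (α ^ 2 * ‖γ t ω‖ ^ 2) := by
    have c0 : 0 ≤ 1 - 7 / 10 * (p * w) := by linarith
    have c1 := mul_le_mul_of_nonneg_left a2 c0
    -- Young's inequality costs `1/10` of the `7/10`; passing from `p w` to `p² w` matches the dual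
    -- rate.
    have c2 : (1 - 7 / 10 * (p * w)) * (1 + p * w / 10) ≤ 1 - 3 / 5 * (p ^ 2 * w) := by
      have : p ^ 2 * w ≤ p * w := by
        have := mul_le_mul_of_nonneg_right hp1 hpw0.le
        linarith [this]
      nlinarith
    have c3 := mul_le_mul_of_nonneg_right c2 (sq_nonneg ‖Q (x t ω)‖)
    have c4 : (1 - 7 / 10 * (p * w)) * ((1 + 10 / (p * w)) * (α ^ 2 * ‖γ t ω‖ ^ 2))
        ≤ (1 + 10 / (p * w)) * (α ^ 2 * ‖γ t ω‖ ^ 2) :=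
      mul_le_of_le_one_left (by positivity) (by linarith)
    linarith
  have a7 : 0 ≤ p ^ 2 * w * (inner ℝ (s t ω) (H (s t ω)) / p ^ 2) :=
    mul_nonneg (by positivity) (div_nonneg (hG.inner_nonneg _) (sq_nonneg p))
  have a8 : (1 - 3 / 5 * (p ^ 2 * w)) * lyapunov H Q p (x t ω) (s t ω)
      = (1 - 3 / 5 * (p ^ 2 * w)) * ‖Q (x t ω)‖ ^ 2
        + (1 - 3 / 5 * (p ^ 2 * w)) * (inner ℝ (s t ω) (H (s t ω)) / p ^ 2) := by
    rw [lyapunov, mul_add]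
  rw [a8]
  linarith

end IsRun

end Run

/-! ### The rate -/

section Rate

variable {lam p χ α μ L : ℝ}

/-- The admissible parameters. -/
structure IsAdmissible (lam p χ α μ L : ℝ) : Prop where
  lam_lt : lam < 1
  le_lam : -1 ≤ lam
  mu_pos : 0 < μ
  mu_le : μ ≤ L
  step_pos : 0 < α
  step_le : α * L ≤ 1 / 2
  prob_pos : 0 < p
  prob_le : p ≤ 1
  one_lt : 1 < p * χ
  gap_lt : 36 < χ * (1 - lam)

namespace IsAdmissible

variable (h : IsAdmissible lam p χ α μ L)
include h

theorem chi_pos : 0 < χ := by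
  have h1 := h.one_lt
  have h2 := h.prob_pos
  by_contra! h3
  nlinarith

/-- Since `1 - λ₂ ≤ 2`, the gap condition alone forces this, and it yields the bound `c = 1/χ ≤
1/18` used in the contraction. -/
theorem chi_gt : 18 < χ := by
  have h1 := h.gap_lt
  have h2 := h.le_lam
  have h3 := h.chi_pos
  nlinarith

theorem gapw_pos : 0 < (1 - lam) / (2 * χ) :=
  div_pos (by linarith [h.lam_lt]) (by linarith [h.chi_pos])

theorem gapw_lt : (1 - lam) / (2 * χ) < 1 / 18 := by
  have := h.chi_gt
  rw [div_lt_div_iff₀ (by linarith) (by norm_num)]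
  linarith [h.le_lam]

theorem delta_pos : 0 < p ^ 2 * ((1 - lam) / (2 * χ)) :=
  mul_pos (pow_pos h.prob_pos 2) h.gapw_pos

theorem delta_lt : p ^ 2 * ((1 - lam) / (2 * χ)) < 1 / 18 := by
  have h1 := h.gapw_lt
  have h2 := h.gapw_pos
  have h3 : p ^ 2 ≤ 1 := pow_le_one₀ h.prob_pos.le h.prob_le
  nlinarith

theorem step_mul_pos : 0 < α * μ := mul_pos h.step_pos h.mu_pos

theorem step_mul_le : α * μ ≤ 1 / 2 :=
  (mul_le_mul_of_nonneg_left h.mu_le h.step_pos.le).trans h.step_le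

theorem gammaS_lt_one : gammaS lam p χ < 1 := by
  have h1 := h.gapw_pos
  have h2 := h.gapw_lt
  have h3 := h.chi_pos
  have h4 := h.gap_lt
  have h5 := h.prob_pos
  have h6 := h.prob_le
  have h7 : Real.sqrt (1 - (1 - lam) / (2 * χ)) < 1 - (1 - lam) / (2 * χ) / 2 := by
    rw [Real.sqrt_lt' (by linarith)]
    nlinarith [pow_pos h1 2]
  -- The numerator is at most `9`, and `9 / χ² ≤ (1 - λ₂) / (4χ)` is the condition `36 ≤ χ (1 -
  -- λ₂)`.
  have h8 : 3 * (1 - p) * (2 + p ^ 2) / χ ^ 2 ≤ (1 - lam) / (2 * χ) / 2 := by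
    rw [div_div, div_le_div_iff₀ (by positivity) (by positivity)]
    have h9 : (1 - p) * (2 + p ^ 2) ≤ 3 := by nlinarith [pow_pos h5 2]
    nlinarith
  rw [gammaS]
  linarith

theorem sqrt_lt_one : Real.sqrt (1 - (1 - lam) * p ^ 2 / (2 * χ)) < 1 := by
  have h1 := h.delta_pos
  rw [Real.sqrt_lt' one_pos]
  have : (1 - lam) * p ^ 2 / (2 * χ) = p ^ 2 * ((1 - lam) / (2 * χ)) := by ring
  linarith

theorem zetaTilde_lt_one : zetaTilde lam p χ α μ < 1 :=
  max_lt (by linarith [h.step_mul_pos]) h.sqrt_lt_one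

theorem zeta_lt_one : zeta lam p χ α μ < 1 := by
  have h1 := h.delta_pos
  have : (1 - lam) * p ^ 2 / (2 * χ) = p ^ 2 * ((1 - lam) / (2 * χ)) := by ring
  exact max_lt (by linarith [h.step_mul_pos]) (by linarith)

/-- For small `δ` the root `√(1 - δ)` is close to `1 - δ/2`; the coefficient `3/5 > 1/2` leaves a
strict margin for `δ < 1/18`. -/
theorem contract_lt_zetaTilde :
    1 - 3 / 5 * (p ^ 2 * ((1 - lam) / (2 * χ))) < zetaTilde lam p χ α μ := by
  have h1 := h.delta_pos
  have h2 := h.delta_lt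
  have e : (1 - lam) * p ^ 2 / (2 * χ) = p ^ 2 * ((1 - lam) / (2 * χ)) := by ring
  refine lt_of_lt_of_le ?_ (le_max_right _ _)
  rw [e]
  refine Real.lt_sqrt_of_sq_lt ?_
  nlinarith

theorem total_lt_zetaTilde :
    max (1 - 3 / 2 * (α * μ)) (1 - p ^ 2 * ((1 - lam) / (2 * χ))) < zetaTilde lam p χ α μ := by
  have h1 := h.delta_pos
  refine max_lt (lt_of_lt_of_le ?_ (le_max_left _ _)) (lt_trans ?_ h.contract_lt_zetaTilde)
  · linarith [h.step_mul_pos]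
  · linarith

theorem total_le_zeta :
    max (1 - 3 / 2 * (α * μ)) (1 - p ^ 2 * ((1 - lam) / (2 * χ))) ≤ zeta lam p χ α μ := by
  have e : (1 - lam) * p ^ 2 / (2 * χ) = p ^ 2 * ((1 - lam) / (2 * χ)) := by ring
  refine max_le_max ?_ ?_
  · linarith [h.step_mul_pos]
  · rw [e]

/-- The size of the noise floor. -/
theorem noise_floor_le {ζ q M : ℝ} (hM : 0 ≤ M) (hq : q ≤ ζ) (hζ : ζ < 1) :
    2 * α * L * ((11 * α ^ 2 * L ^ 2 / (p * ((1 - lam) / (2 * χ))) * (α ^ 2 * M / (1 - q))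
        + α ^ 2 * M) / (3 / 5 * (p ^ 2 * ((1 - lam) / (2 * χ))))) / (α * μ)
      ≤ 200 * (α ^ 4 * M * L ^ 3 * χ ^ 4 / (μ * p ^ 2 * (1 - lam) ^ 2 * (1 - ζ))
        + α ^ 2 * M * L * χ ^ 3 / (μ * p ^ 2 * (1 - lam))) := by
  have hp := h.prob_pos
  have hχ := h.chi_pos
  have hα := h.step_pos
  have hμ := h.mu_pos
  have hL : 0 < L := hμ.trans_le h.mu_le
  have hg : 0 < 1 - lam := by linarith [h.lam_lt]
  have hz : 0 < 1 - ζ := by linarith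
  have hz' : 0 < 1 - q := by linarith
  have hχ1 : 1 ≤ χ := by linarith [h.chi_gt]
  set g := 1 - lam
  have e : 2 * α * L * ((11 * α ^ 2 * L ^ 2 / (p * (g / (2 * χ))) * (α ^ 2 * M / (1 - q))
        + α ^ 2 * M) / (3 / 5 * (p ^ 2 * (g / (2 * χ))))) / (α * μ)
      = 440 / 3 * (α ^ 4 * M * L ^ 3 / (μ * p ^ 2 * g ^ 2)) * (χ ^ 2 / p) * (1 / (1 - q))
        + 20 / 3 * (α ^ 2 * M * L / (μ * p ^ 2 * g)) * χ := by
    field_simp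
    ring
  have e' : 200 * (α ^ 4 * M * L ^ 3 * χ ^ 4 / (μ * p ^ 2 * g ^ 2 * (1 - ζ))
        + α ^ 2 * M * L * χ ^ 3 / (μ * p ^ 2 * g))
      = 200 * (α ^ 4 * M * L ^ 3 / (μ * p ^ 2 * g ^ 2)) * χ ^ 4 * (1 / (1 - ζ))
        + 200 * (α ^ 2 * M * L / (μ * p ^ 2 * g)) * χ ^ 3 := by
    field_simp
  rw [e, e']
  -- The spare powers of `χ` pay for `1/p`, through `1 < pχ`. Both constants `440/3` and `20/3` are
  -- below `200`.
  have h1 : χ ^ 2 / p ≤ χ ^ 4 := by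
    rw [div_le_iff₀ hp]
    calc χ ^ 2 = χ ^ 2 * (1 * 1) := by ring
      _ ≤ χ ^ 2 * (χ * (p * χ)) := by have := h.one_lt.le; gcongr
      _ = χ ^ 4 * p := by ring
  have h2 : χ ≤ χ ^ 3 := le_self_pow₀ hχ1 (by norm_num)
  have h3 : 1 / (1 - q) ≤ 1 / (1 - ζ) := one_div_le_one_div_of_le hz (by linarith)
  gcongr <;> norm_num

/-- The bound obtained from the three coupled one-step recursions. -/
theorem exists_bound {E0 V0 : ℝ} (hE0 : 0 ≤ E0) (hV0 : 0 ≤ V0) :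
    ∃ a₀ : ℝ, ∀ (E V : ℕ → ℝ) (M N : ℝ), 0 ≤ M → 0 ≤ N → E 0 = E0 → V 0 = V0 →
      (∀ t, E (t + 1) + V (t + 1)
        ≤ max (1 - 3 / 2 * (α * μ)) (1 - p ^ 2 * ((1 - lam) / (2 * χ))) * (E t + V t)
          + α ^ 2 * M) →
      (∀ t, V (t + 1) ≤ (1 - 3 / 5 * (p ^ 2 * ((1 - lam) / (2 * χ)))) * V t
        + (11 * α ^ 2 * L ^ 2 / (p * ((1 - lam) / (2 * χ)))) * (E t + V t) + α ^ 2 * M) →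
      (∀ t, E (t + 1) ≤ (1 - α * μ) * E t + 2 * α * L * V t + α ^ 2 * N) →
      ∀ t, E t ≤ zetaTilde lam p χ α μ ^ t * a₀
        + 200 * (α ^ 4 * M * L ^ 3 * χ ^ 4 /
              (μ * p ^ 2 * (1 - lam) ^ 2 * (1 - zeta lam p χ α μ))
            + α ^ 2 * M * L * χ ^ 3 / (μ * p ^ 2 * (1 - lam)))
        + α * N / μ := by
  have hp := h.prob_pos
  have hα := h.step_pos
  have hμ := h.mu_pos
  have hL : 0 < L := hμ.trans_le h.mu_le
  have hw := h.gapw_pos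
  have hδ := h.delta_pos
  have hδ' := h.delta_lt
  have hαμ := h.step_mul_pos
  have hαμ' := h.step_mul_le
  have hqz := h.total_le_zeta
  have hrt := h.contract_lt_zetaTilde
  have hqt := h.total_lt_zetaTilde
  have hζ1 := h.zeta_lt_one
  set q := max (1 - 3 / 2 * (α * μ)) (1 - p ^ 2 * ((1 - lam) / (2 * χ))) with hq
  set A := 11 * α ^ 2 * L ^ 2 / (p * ((1 - lam) / (2 * χ))) with hA
  set r := 1 - 3 / 5 * (p ^ 2 * ((1 - lam) / (2 * χ))) with hr
  set T := zetaTilde lam p χ α μ with hT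
  -- An intermediate rate: `V` is bounded at rate `s > q`, and `s < T` leaves room for the recursion
  -- of `E`, whose own factor `1 - αμ` may equal `T`.
  set s := (max q r + T) / 2 with hs
  have hq0 : 0 ≤ q := le_trans (by linarith) (le_max_right _ _)
  have hmax : max q r < T := max_lt hqt hrt
  have hqs : q < s := by have := le_max_left q r; linarith
  have hrs : r ≤ s := by have := le_max_right q r; linarith
  have hsT : s < T := by linarith
  have hs0 : 0 ≤ s := hq0.trans hqs.le
  have hA0 : 0 ≤ A := by positivity
  have hμT : 1 - α * μ ≤ T := le_max_left _ _
  set K2 := V0 + A * (E0 + V0) / (s - q) with hK2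
  have hsq : 0 < s - q := by linarith
  have hK20 : 0 ≤ K2 := by positivity
  -- The witness uses the initial energies and the rates only, so it is fixed before the sequences
  -- and the noise levels.
  refine ⟨E0 + 2 * α * L * K2 / (T - s), fun E V M N hM hN hE hV h1 h2 h3 t => ?_⟩
  have hM' : 0 ≤ α ^ 2 * M := by positivity
  have hN' : 0 ≤ α ^ 2 * N := by positivity
  have hq1 : q < 1 := lt_of_le_of_lt hqz hζ1
  have hr1 : r < 1 := by rw [hr]; linarith
  have b1 : ∀ t, E t + V t ≤ (E0 + V0) * q ^ t + α ^ 2 * M / (1 - q) := by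
    intro t
    have hM1 : q * (α ^ 2 * M / (1 - q)) + α ^ 2 * M = α ^ 2 * M / (1 - q) := by
      have : (1 - q) ≠ 0 := by linarith
      field_simp; ring
    have hM2 : 0 ≤ α ^ 2 * M / (1 - q) := div_nonneg hM' (by linarith)
    induction t with
    | zero => rw [hE, hV]; simp; exact hM2
    | succ t ih =>
      have := mul_le_mul_of_nonneg_left ih hq0
      rw [pow_succ]
      linarith [h1 t]
  have b2 := le_geometric_add_of_le (a := V) (b := fun t => E t + V t) (ρ := r) (ρ' := s) (s := q)
    (c := A) (K := E0 + V0) (N := α ^ 2 * M / (1 - q)) (d := α ^ 2 * M) (by rw [hr]; linarith) hr1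
    hrs hq0 hqs hA0 (by linarith) (div_nonneg hM' (by linarith)) hM' (by rw [hV]; exact hV0) b1 h2
  rw [hV, ← hK2] at b2
  have hN2 : 0 ≤ (A * (α ^ 2 * M / (1 - q)) + α ^ 2 * M) / (1 - r) := by
    have : 0 ≤ α ^ 2 * M / (1 - q) := div_nonneg hM' (by linarith)
    exact div_nonneg (by positivity) (by linarith)
  -- The bound `b2` on `V` is now the input of the third recursion, with its noise floor in the role
  -- of `N`.
  have b3 := le_geometric_add_of_le (a := E) (b := V) (ρ := 1 - α * μ) (ρ' := T) (s := s)
    (c := 2 * α * L) (K := K2) (N := (A * (α ^ 2 * M / (1 - q)) + α ^ 2 * M) / (1 - r))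
    (d := α ^ 2 * N) (by linarith) (by linarith) hμT hs0 hsT (by positivity) hK20 hN2 hN'
    (by rw [hE]; exact hE0) b2 h3 t
  rw [hE] at b3
  refine b3.trans ?_
  have e1 : 1 - (1 - α * μ) = α * μ := by ring
  have e2 : 1 - r = 3 / 5 * (p ^ 2 * ((1 - lam) / (2 * χ))) := by rw [hr]; ring
  have e3 : α ^ 2 * N / (α * μ) = α * N / μ := by field_simp
  have b4 := h.noise_floor_le hM hqz hζ1
  rw [e1, add_div, e3, e2, mul_comm (T ^ t)]
  linarith

end IsAdmissible

end Rate

/-! ### ProxSkip in coordinates centered at the optimum -/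

section Centered

variable {n d : ℕ}

/-- The primal error. -/
def primalErr (xs : Vec d) (X : Stack n d) : NodeSpace n d := WithLp.toLp 2 fun i => X i - xs

/-- The deviation of the exact gradients from the gradients at the optimum. -/
def gradErr (f : Fin n → Vec d → ℝ) (xs : Vec d) (X : Stack n d) : NodeSpace n d :=
  WithLp.toLp 2 fun i => gradient (f i) (X i) - gradient (f i) xs

/-- The gradients at the optimum. -/
def optGrad (f : Fin n → Vec d → ℝ) (xs : Vec d) : NodeSpace n d :=
  WithLp.toLp 2 fun i => gradient (f i) xs

/-- The noise of the stochastic gradients. -/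
def gradNoise {Ξ : Fin n → Type u} (f : Fin n → Vec d → ℝ) (F : ∀ i, Vec d → Ξ i → ℝ)
    (X : Stack n d) (s : ∀ i, Ξ i) : NodeSpace n d :=
  WithLp.toLp 2 fun i => stochGrad F X s i - gradient (f i) (X i)

/-- The dual error is the image of this variable under the gossip operator. -/
def dualVar {Ξ : Fin n → Type u} (f : Fin n → Vec d → ℝ) (F : ∀ i, Vec d → Ξ i → ℝ)
    (W : Matrix (Fin n) (Fin n) ℝ) (α p χ : ℝ) (x₀ xs : Vec d) (s₀ : NodeSpace n d)
    (ξ : ℕ → ∀ i, Ξ i) (θ : ℕ → Bool) : ℕ → NodeSpace n d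
  | 0 => s₀
  | t + 1 =>
    let s := dualVar f F W α p χ x₀ xs s₀ ξ θ t
    let X := (iterates F W α p χ x₀ ξ θ t).1
    s + if θ t then p • (primalErr xs X - α • gradErr f xs X - gossipOp W χ d s
      - α • gradNoise f F X (ξ t)) else 0

theorem toLp_step_fst {χ : ℝ} (α β : ℝ) (W : Matrix (Fin n) (Fin n) ℝ) (θ : Bool) (G : Stack n d)
    (S : Stack n d × Stack n d) :
    WithLp.toLp 2 (step α β (mixingA χ W) θ G S).1
      = WithLp.toLp 2 (S.1 - α • G - S.2)
        - if θ then gossipOp W χ d (WithLp.toLp 2 (S.1 - α • G - S.2)) else 0 := by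
  cases θ
  · simp [step]
  · simp only [step, if_true, mix_mixingA, WithLp.toLp_sub, WithLp.toLp_ofLp]

theorem toLp_step_snd {χ : ℝ} (α β : ℝ) (W : Matrix (Fin n) (Fin n) ℝ) (θ : Bool) (G : Stack n d)
    (S : Stack n d × Stack n d) :
    WithLp.toLp 2 (step α β (mixingA χ W) θ G S).2
      = WithLp.toLp 2 S.2
        + if θ then β • gossipOp W χ d (WithLp.toLp 2 (S.1 - α • G - S.2)) else 0 := by
  cases θ
  · simp [step]
  · simp only [step, if_true, mix_mixingA, WithLp.toLp_add, WithLp.toLp_smul, sub_sub_cancel,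
      WithLp.toLp_ofLp]

theorem centerOp_const (hn : 0 < n) (c : Vec d) :
    centerOp n d (WithLp.toLp 2 fun _ => c) = 0 := by
  ext i : 1
  rw [centerOp_apply]
  change c - nodeMean (fun _ => c) = 0
  rw [nodeMean_const hn, sub_self]

variable {W : Matrix (Fin n) (Fin n) ℝ} {χ : ℝ}

theorem IsGossip.gossipOp_const {w c : ℝ} (h : IsGossip (gossipOp W χ d) (centerOp n d) w c)
    (hn : 0 < n) (v : Vec d) : gossipOp W χ d (WithLp.toLp 2 fun _ => v) = 0 := by
  rw [← h.apply_proj, centerOp_const hn, map_zero]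

theorem primalErr_eq (xs : Vec d) (X : Stack n d) :
    primalErr xs X = WithLp.toLp 2 X - WithLp.toLp 2 (fun _ => xs) := rfl

-- The centred dynamics of the primal and dual errors

section Dynamics

variable {Ξ : Fin n → Type u} {f : Fin n → Vec d → ℝ} {F : ∀ i, Vec d → Ξ i → ℝ}
  {α p : ℝ} {x₀ xs : Vec d} {s₀ : NodeSpace n d} {ξ : ℕ → ∀ i, Ξ i} {θ : ℕ → Bool} {w c : ℝ}

/-- The gradients at the optimum cancel the offset of the dual variable, leaving error terms and the
constant stack `x⋆`, which `H` annihilates. -/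
theorem toLp_halfStep (X Y : Stack n d) (s : ∀ i, Ξ i) (H : NodeSpace n d)
    (hY : WithLp.toLp 2 Y = H - α • optGrad f xs) :
    WithLp.toLp 2 (X - α • stochGrad F X s - Y)
      = (primalErr xs X - α • gradErr f xs X - H - α • gradNoise f F X s)
        + WithLp.toLp 2 (fun _ => xs) := by
  have h1 : WithLp.toLp 2 (stochGrad F X s)
      = optGrad f xs + gradErr f xs X + gradNoise f F X s := by
    ext i : 1
    simp [optGrad, gradErr, gradNoise]
  rw [WithLp.toLp_sub, WithLp.toLp_sub, WithLp.toLp_smul, hY, h1, primalErr_eq, smul_add, smul_add]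
  abel

theorem toLp_dual_eq (h : IsGossip (gossipOp W χ d) (centerOp n d) w c) (hn : 0 < n)
    (hs₀ : gossipOp W χ d s₀ = α • optGrad f xs) (t : ℕ) :
    WithLp.toLp 2 (iterates F W α p χ x₀ ξ θ t).2
      = gossipOp W χ d (dualVar f F W α p χ x₀ xs s₀ ξ θ t) - α • optGrad f xs := by
  induction t with
  | zero =>
    rw [dualVar, hs₀, sub_self]
    rfl
  | succ t ih =>
    have hz := toLp_halfStep (F := F) (iterates F W α p χ x₀ ξ θ t).1
      (iterates F W α p χ x₀ ξ θ t).2 (ξ t) _ ih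
    simp only [iterates, dualVar, toLp_step_snd]
    rw [hz, ih, map_add, map_add, h.gossipOp_const hn, add_zero]
    by_cases hθ : θ t = true
    · simp only [hθ, if_true, map_smul]; abel
    · simp [hθ]

theorem primalErr_succ (h : IsGossip (gossipOp W χ d) (centerOp n d) w c) (hn : 0 < n)
    (hs₀ : gossipOp W χ d s₀ = α • optGrad f xs) (t : ℕ) :
    primalErr xs (iterates F W α p χ x₀ ξ θ (t + 1)).1
      = (primalErr xs (iterates F W α p χ x₀ ξ θ t).1
          - α • gradErr f xs (iterates F W α p χ x₀ ξ θ t).1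
          - gossipOp W χ d (dualVar f F W α p χ x₀ xs s₀ ξ θ t)
          - α • gradNoise f F (iterates F W α p χ x₀ ξ θ t).1 (ξ t))
        - if θ t then gossipOp W χ d (primalErr xs (iterates F W α p χ x₀ ξ θ t).1
          - α • gradErr f xs (iterates F W α p χ x₀ ξ θ t).1
          - gossipOp W χ d (dualVar f F W α p χ x₀ xs s₀ ξ θ t)
          - α • gradNoise f F (iterates F W α p χ x₀ ξ θ t).1 (ξ t)) else 0 := by
  have hz := toLp_halfStep (F := F) (iterates F W α p χ x₀ ξ θ t).1
    (iterates F W α p χ x₀ ξ θ t).2 (ξ t) _ (toLp_dual_eq h hn hs₀ t)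
  rw [primalErr_eq, iterates, toLp_step_fst, hz, map_add (gossipOp W χ d), h.gossipOp_const hn,
    add_zero]
  abel

end Dynamics

/-! ### Pointwise bounds along a run -/

section Pointwise

variable {f : Fin n → Vec d → ℝ} {L μ α : ℝ} {xs : Vec d}

theorem norm_sub_centerOp_sq (x : NodeSpace n d) :
    ‖x - centerOp n d x‖ ^ 2 = n * ‖nodeMean x.ofLp‖ ^ 2 := by
  have h : x - centerOp n d x = WithLp.toLp 2 fun _ => nodeMean x.ofLp := by
    ext i : 1
    rw [PiLp.sub_apply, centerOp_apply, sub_sub_cancel]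
  rw [h, PiLp.norm_sq_eq_of_L2]
  simp

theorem nodeMean_primalErr (hn : 0 < n) (X : Stack n d) :
    nodeMean (primalErr xs X).ofLp = nodeMean X - xs := by
  have : (primalErr xs X).ofLp = X - fun _ => xs := rfl
  rw [this, nodeMean_sub, nodeMean_const hn]

theorem nodeMean_optGrad (hn : 0 < n) (hg : ∀ i, IsSmooth L (f i))
    (hmin : ∀ x, globalLoss f xs ≤ globalLoss f x) : nodeMean (optGrad f xs).ofLp = 0 := by
  rw [nodeMean]
  change (1 / (n : ℝ)) • ∑ i, gradient (f i) xs = 0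
  rw [sum_gradient_eq_zero hn (fun i => (hg i).1) hmin, smul_zero]

theorem centerOp_optGrad (hn : 0 < n) (hg : ∀ i, IsSmooth L (f i))
    (hmin : ∀ x, globalLoss f xs ≤ globalLoss f x) :
    centerOp n d (optGrad f xs) = optGrad f xs := by
  ext i : 1
  rw [centerOp_apply, nodeMean_optGrad hn hg hmin, sub_zero]

theorem norm_primalErr_step_sq_le (hμ : 0 < μ) (hL : 0 < L) (hg : ∀ i, IsSmooth L (f i))
    (hc : ∀ i, IsStronglyConvex μ (f i)) (hα : 0 < α) (hαL : α * L ≤ 1 / 2) (X : Stack n d) :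
    ‖primalErr xs X - α • gradErr f xs X‖ ^ 2
      ≤ (1 - 3 / 2 * (α * μ)) * ‖primalErr xs X‖ ^ 2 := by
  rw [PiLp.norm_sq_eq_of_L2, PiLp.norm_sq_eq_of_L2, Finset.mul_sum]
  exact Finset.sum_le_sum fun i _ =>
    (hc i).norm_gradient_step_sq_le hμ.le hL (hg i) hα hαL (X i) xs

theorem norm_gradErr_le (hL : 0 ≤ L) (hg : ∀ i, IsSmooth L (f i)) (X : Stack n d) :
    ‖gradErr f xs X‖ ≤ L * ‖primalErr xs X‖ := by
  refine (sq_le_sq₀ (norm_nonneg _) (by positivity)).1 ?_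
  rw [mul_pow, PiLp.norm_sq_eq_of_L2, PiLp.norm_sq_eq_of_L2, Finset.mul_sum]
  refine Finset.sum_le_sum fun i _ => ?_
  rw [← mul_pow]
  exact pow_le_pow_left₀ (norm_nonneg _) ((hg i).2 (X i) xs) 2

theorem norm_mean_primalErr_step_sq_le (hn : 0 < n) (hμ : 0 < μ) (hL : 0 < L)
    (hg : ∀ i, IsSmooth L (f i)) (hc : ∀ i, IsStronglyConvex μ (f i))
    (hmin : ∀ x, globalLoss f xs ≤ globalLoss f x) (hα : 0 < α) (hαL : α * L ≤ 1 / 2)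
    (X : Stack n d) :
    ‖primalErr xs X - α • gradErr f xs X
        - centerOp n d (primalErr xs X - α • gradErr f xs X)‖ ^ 2
      ≤ (1 - α * μ) * ‖primalErr xs X - centerOp n d (primalErr xs X)‖ ^ 2
        + 2 * α * L * ‖centerOp n d (primalErr xs X)‖ ^ 2 := by
  have hn' : (0 : ℝ) < n := by positivity
  have h1 : nodeMean (primalErr xs X - α • gradErr f xs X).ofLp
      = nodeMean X - xs - α • nodeMean (fun i => gradient (f i) (X i)) := by
    have e1 : (primalErr xs X - α • gradErr f xs X).ofLp = (primalErr xs X).ofLp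
        - α • ((fun i => gradient (f i) (X i)) - (optGrad f xs).ofLp) := rfl
    rw [e1, nodeMean_sub, nodeMean_primalErr hn, nodeMean_smul, nodeMean_sub,
      nodeMean_optGrad hn hg hmin, sub_zero]
  have h2 : ‖centerOp n d (primalErr xs X)‖ ^ 2 = ∑ i, ‖X i - nodeMean X‖ ^ 2 := by
    rw [primalErr_eq, map_sub, centerOp_const hn, sub_zero, norm_centerOp_sq]
  have h3 := mul_le_mul_of_nonneg_left
    (norm_nodeMean_step_sq_le hn hμ hL hg hc hmin hα hαL X) hn'.le
  rw [norm_sub_centerOp_sq, norm_sub_centerOp_sq, nodeMean_primalErr hn, h1, h2]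
  refine h3.trans (le_of_eq ?_)
  field_simp

end Pointwise

end Centered

/-! ### The past of an iteration -/

section History

variable {n d : ℕ} {Ξ : Fin n → Type u} [∀ i, MeasurableSpace (Ξ i)] {Ω : Type v}

/-- The σ-algebras generated by the samples and the coins. -/
abbrev sourceAlgebra (ξ : ℕ → ∀ i, Ω → Ξ i) (θ : ℕ → Ω → Bool) :
    (ℕ × Fin n) ⊕ ℕ → MeasurableSpace Ω :=
  Sum.elim
    (fun k : ℕ × Fin n => MeasurableSpace.comap (ξ k.1 k.2) inferInstance)
    (fun t : ℕ => MeasurableSpace.comap (θ t) inferInstance)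

/-- The samples and coins used before iteration `t`. -/
def pastIndex (n t : ℕ) : Set ((ℕ × Fin n) ⊕ ℕ) := {j | Sum.elim Prod.fst id j < t}

/-- The samples and coins used before iteration `t`, and the samples of iteration `t`. -/
def presentIndex (n t : ℕ) : Set ((ℕ × Fin n) ⊕ ℕ) := pastIndex n t ∪ {j | ∃ i, j = Sum.inl (t, i)}

/-- The σ-algebra generated by a set of samples and coins. -/
abbrev history (ξ : ℕ → ∀ i, Ω → Ξ i) (θ : ℕ → Ω → Bool) (S : Set ((ℕ × Fin n) ⊕ ℕ)) :
    MeasurableSpace Ω :=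
  ⨆ j ∈ S, sourceAlgebra ξ θ j

variable {ξ : ℕ → ∀ i, Ω → Ξ i} {θ : ℕ → Ω → Bool}

theorem history_mono {S T : Set ((ℕ × Fin n) ⊕ ℕ)} (h : S ⊆ T) : history ξ θ S ≤ history ξ θ T :=
  biSup_mono fun _ hj => h hj

theorem measurable_sample_history {S : Set ((ℕ × Fin n) ⊕ ℕ)} {t : ℕ} {i : Fin n}
    (h : Sum.inl (t, i) ∈ S) : Measurable[history ξ θ S] (ξ t i) :=
  Measurable.mono (comap_measurable (ξ t i))
    (le_iSup₂ (f := fun j (_ : j ∈ S) => sourceAlgebra ξ θ j) (Sum.inl (t, i)) h) le_rfl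

theorem measurable_coin_history {S : Set ((ℕ × Fin n) ⊕ ℕ)} {t : ℕ}
    (h : Sum.inr t ∈ S) : Measurable[history ξ θ S] (θ t) :=
  Measurable.mono (comap_measurable (θ t))
    (le_iSup₂ (f := fun j (_ : j ∈ S) => sourceAlgebra ξ θ j) (Sum.inr t) h) le_rfl

theorem pastIndex_subset_presentIndex (n t : ℕ) : pastIndex n t ⊆ presentIndex n t :=
  Set.subset_union_left

theorem presentIndex_subset_pastIndex_succ (n t : ℕ) :
    presentIndex n t ⊆ pastIndex n (t + 1) := by
  rintro j (hj | ⟨i, rfl⟩)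
  · exact Nat.lt_succ_of_lt hj
  · exact Nat.lt_succ_self t

variable {D : ∀ i, Measure (Ξ i)} {p : ℝ} [MeasurableSpace Ω] {P : Measure Ω}

theorem IsSampling.sourceAlgebra_le (h : IsSampling D p P ξ θ) (j : (ℕ × Fin n) ⊕ ℕ) :
    sourceAlgebra ξ θ j ≤ ‹MeasurableSpace Ω› := by
  rcases j with ⟨t, i⟩ | t
  · exact (h.measurable_sample t i).comap_le
  · exact (h.measurable_coin t).comap_le

theorem IsSampling.history_le (h : IsSampling D p P ξ θ) (S : Set ((ℕ × Fin n) ⊕ ℕ)) :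
    history ξ θ S ≤ ‹MeasurableSpace Ω› :=
  iSup₂_le fun j _ => h.sourceAlgebra_le j

theorem IsSampling.indep_history (h : IsSampling D p P ξ θ) {S : Set ((ℕ × Fin n) ⊕ ℕ)}
    {j : (ℕ × Fin n) ⊕ ℕ} (hj : j ∉ S) : Indep (history ξ θ S) (sourceAlgebra ξ θ j) P := by
  have h1 := indep_iSup_of_disjoint h.sourceAlgebra_le h.indep
    (Set.disjoint_singleton_right.2 hj)
  simpa only [Set.mem_singleton_iff, iSup_iSup_eq_left] using h1

end History

/-! ### Measurability of the iterates -/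

section Measurability

variable {n d : ℕ} {Ξ : Fin n → Type u} [∀ i, MeasurableSpace (Ξ i)] {Ω : Type v}
  {D : ∀ i, Measure (Ξ i)} {f : Fin n → Vec d → ℝ} {F : ∀ i, Vec d → Ξ i → ℝ}
  {W : Matrix (Fin n) (Fin n) ℝ} {α p χ L : ℝ} {x₀ xs : Vec d} {s₀ : NodeSpace n d}
  {ξ : ℕ → ∀ i, Ω → Ξ i} {θ : ℕ → Ω → Bool}

theorem IsSmooth.measurable_gradient {g : Vec d → ℝ} (hg : IsSmooth L g) :
    Measurable (gradient g) := by
  have h : LipschitzWith L.toNNReal (gradient g) := by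
    refine LipschitzWith.of_dist_le' fun x y => ?_
    rw [dist_eq_norm, dist_eq_norm]
    exact hg.2 x y
  exact h.continuous.measurable

theorem measurable_step (α β : ℝ) (A : Matrix (Fin n) (Fin n) ℝ) :
    Measurable fun q : Bool × Stack n d × (Stack n d × Stack n d) =>
      step α β A q.1 q.2.1 q.2.2 := by
  have hmix : Measurable (mix A : Stack n d → Stack n d) := by
    unfold mix
    fun_prop
  have hZ : Measurable fun q : Bool × Stack n d × (Stack n d × Stack n d) =>
      q.2.2.1 - α • q.2.1 - q.2.2.2 := by fun_prop
  have hX : Measurable fun q : Bool × Stack n d × (Stack n d × Stack n d) =>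
      if q.1 then mix A (q.2.2.1 - α • q.2.1 - q.2.2.2) else q.2.2.1 - α • q.2.1 - q.2.2.2 :=
    Measurable.ite (measurable_fst (measurableSet_singleton true)) (hmix.comp hZ) hZ
  exact hX.prodMk ((measurable_snd.comp (measurable_snd.comp measurable_snd)).add
    ((hZ.sub hX).const_smul β))

variable (ξ θ F W α p χ x₀) in
/-- The random iterates. -/
def randomIterates (t : ℕ) (ω : Ω) : Stack n d × Stack n d :=
  iterates F W α p χ x₀ (fun s i => ξ s i ω) (fun s => θ s ω) t

theorem IsStochasticLoss.measurable_stochGrad {m : MeasurableSpace Ω}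
    (hF : IsStochasticLoss f D F) {X : Ω → Stack n d}
    {s : ∀ i, Ω → Ξ i} (i : Fin n) (hX : Measurable[m] fun ω => X ω i) (hs : Measurable[m] (s i)) :
    Measurable[m] fun ω => stochGrad F (X ω) (fun j => s j ω) i :=
  (hF.measurable_gradient i).comp (hX.prodMk hs)

theorem measurable_randomIterates (hF : IsStochasticLoss f D F) (t : ℕ) :
    Measurable[history ξ θ (pastIndex n t)] (randomIterates F W α p χ x₀ ξ θ t) := by
  induction t with
  | zero => exact @measurable_const _ _ _ (history ξ θ (pastIndex n 0)) _
  | succ t ih =>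
    have hle : history ξ θ (pastIndex n t) ≤ history ξ θ (pastIndex n (t + 1)) :=
      history_mono ((pastIndex_subset_presentIndex n t).trans
        (presentIndex_subset_pastIndex_succ n t))
    have h1 := ih.mono hle le_rfl
    have h2 : Measurable[history ξ θ (pastIndex n (t + 1))] (θ t) :=
      measurable_coin_history (Nat.lt_succ_self t)
    have h3 : Measurable[history ξ θ (pastIndex n (t + 1))] fun ω =>
        stochGrad F (randomIterates F W α p χ x₀ ξ θ t ω).1 (fun j => ξ t j ω) := by
      refine @measurable_pi_lambda _ _ _ (history ξ θ (pastIndex n (t + 1))) _ _ fun i => ?_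
      exact hF.measurable_stochGrad i ((measurable_pi_apply i).comp (measurable_fst.comp h1))
        (measurable_sample_history (Nat.lt_succ_self t))
    exact (measurable_step α p (mixingA χ W)).comp (h2.prodMk (h3.prodMk h1))

theorem measurable_toLp_of_apply {m : MeasurableSpace Ω} {g : Ω → Fin n → Vec d}
    (h : ∀ i, Measurable[m] fun ω => g ω i) :
    Measurable[m] fun ω => (WithLp.toLp 2 (g ω) : NodeSpace n d) :=
  (WithLp.measurable_toLp 2 _).comp (measurable_pi_lambda _ h)

end Measurability

/-! ### The run satisfies the hypotheses of the one-step recursions -/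

section Main

variable {n d : ℕ} {Ξ : Fin n → Type u} [∀ i, MeasurableSpace (Ξ i)] {Ω : Type v}
  {D : ∀ i, Measure (Ξ i)} {f : Fin n → Vec d → ℝ} {F : ∀ i, Vec d → Ξ i → ℝ}
  {W : Matrix (Fin n) (Fin n) ℝ} {α p χ L μ σ w c : ℝ} {x₀ xs : Vec d} {s₀ : NodeSpace n d}
  {ξ : ℕ → ∀ i, Ω → Ξ i} {θ : ℕ → Ω → Bool}

variable (f F W α p χ x₀ xs s₀ ξ θ)

/-- The random primal error. -/
def runX (t : ℕ) (ω : Ω) : NodeSpace n d :=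
  primalErr xs (randomIterates F W α p χ x₀ ξ θ t ω).1

/-- The random dual variable. -/
def runS (t : ℕ) (ω : Ω) : NodeSpace n d :=
  dualVar f F W α p χ x₀ xs s₀ (fun s i => ξ s i ω) (fun s => θ s ω) t

/-- The random error of the exact gradients. -/
def runGrad (t : ℕ) (ω : Ω) : NodeSpace n d :=
  gradErr f xs (randomIterates F W α p χ x₀ ξ θ t ω).1

/-- The noise of the stochastic gradients. -/
def runNoise (t : ℕ) (ω : Ω) : NodeSpace n d :=
  gradNoise f F (randomIterates F W α p χ x₀ ξ θ t ω).1 (fun i => ξ t i ω)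

variable {f F W α p χ x₀ xs s₀ ξ θ}

theorem measurable_runX (hF : IsStochasticLoss f D F) (t : ℕ) :
    Measurable[history ξ θ (pastIndex n t)] (runX F W α p χ x₀ xs ξ θ t) :=
  measurable_toLp_of_apply fun i => ((measurable_pi_apply i).comp
    (measurable_fst.comp (measurable_randomIterates hF t))).sub_const xs

theorem measurable_runGrad (hF : IsStochasticLoss f D F) (hg : ∀ i, IsSmooth L (f i)) (t : ℕ) :
    Measurable[history ξ θ (pastIndex n t)] (runGrad f F W α p χ x₀ xs ξ θ t) :=
  measurable_toLp_of_apply fun i => ((hg i).measurable_gradient.comp ((measurable_pi_apply i).comp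
    (measurable_fst.comp (measurable_randomIterates hF t)))).sub_const _

theorem measurable_noise_apply (hF : IsStochasticLoss f D F) (hg : ∀ i, IsSmooth L (f i)) (t : ℕ)
    {S : Set ((ℕ × Fin n) ⊕ ℕ)} (hS : pastIndex n t ⊆ S) {i : Fin n} (hi : Sum.inl (t, i) ∈ S) :
    Measurable[history ξ θ S] fun ω => runNoise f F W α p χ x₀ ξ θ t ω i := by
  have h1 : Measurable[history ξ θ S] fun ω => (randomIterates F W α p χ x₀ ξ θ t ω).1 i :=
    (measurable_pi_apply i).comp (measurable_fst.comp
      ((measurable_randomIterates hF t).mono (history_mono hS) le_rfl))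
  exact (hF.measurable_stochGrad i h1 (measurable_sample_history hi)).sub
    ((hg i).measurable_gradient.comp h1)

theorem measurable_runNoise (hF : IsStochasticLoss f D F) (hg : ∀ i, IsSmooth L (f i)) (t : ℕ) :
    Measurable[history ξ θ (presentIndex n t)] (runNoise f F W α p χ x₀ ξ θ t) :=
  measurable_toLp_of_apply fun i =>
    measurable_noise_apply hF hg t (pastIndex_subset_presentIndex n t) (Or.inr ⟨i, rfl⟩)

omit [∀ i, MeasurableSpace (Ξ i)] in
theorem runX_succ (hG : IsGossip (gossipOp W χ d) (centerOp n d) w c) (hn : 0 < n)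
    (hs₀ : gossipOp W χ d s₀ = α • optGrad f xs) (t : ℕ) (ω : Ω) :
    runX F W α p χ x₀ xs ξ θ (t + 1) ω =
      (runX F W α p χ x₀ xs ξ θ t ω - α • runGrad f F W α p χ x₀ xs ξ θ t ω
        - gossipOp W χ d (runS f F W α p χ x₀ xs s₀ ξ θ t ω)
        - α • runNoise f F W α p χ x₀ ξ θ t ω)
      - if θ t ω then gossipOp W χ d
          (runX F W α p χ x₀ xs ξ θ t ω - α • runGrad f F W α p χ x₀ xs ξ θ t ω
          - gossipOp W χ d (runS f F W α p χ x₀ xs s₀ ξ θ t ω)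
          - α • runNoise f F W α p χ x₀ ξ θ t ω) else 0 :=
  primalErr_succ hG hn hs₀ t

omit [∀ i, MeasurableSpace (Ξ i)] in
theorem runS_succ (t : ℕ) (ω : Ω) :
    runS f F W α p χ x₀ xs s₀ ξ θ (t + 1) ω = runS f F W α p χ x₀ xs s₀ ξ θ t ω
      + if θ t ω then p •
          (runX F W α p χ x₀ xs ξ θ t ω - α • runGrad f F W α p χ x₀ xs ξ θ t ω
          - gossipOp W χ d (runS f F W α p χ x₀ xs s₀ ξ θ t ω)
          - α • runNoise f F W α p χ x₀ ξ θ t ω) else 0 :=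
  rfl

theorem measurable_runS (hF : IsStochasticLoss f D F) (hg : ∀ i, IsSmooth L (f i)) (t : ℕ) :
    Measurable[history ξ θ (pastIndex n t)] (runS f F W α p χ x₀ xs s₀ ξ θ t) := by
  induction t with
  | zero => exact @measurable_const _ _ _ (history ξ θ (pastIndex n 0)) _
  | succ t ih =>
    have hle := history_mono (ξ := ξ) (θ := θ) (presentIndex_subset_pastIndex_succ n t)
    have hle' := (history_mono (ξ := ξ) (θ := θ) (pastIndex_subset_presentIndex n t)).trans hle
    have hs := ih.mono hle' le_rfl
    have h2 : Measurable[history ξ θ (pastIndex n (t + 1))] (θ t) :=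
      measurable_coin_history (Nat.lt_succ_self t)
    have hz := ((((measurable_runX (W := W) (α := α) (p := p) (χ := χ) (x₀ := x₀) (xs := xs)
      (ξ := ξ) (θ := θ) hF t).mono hle' le_rfl).sub
      (((measurable_runGrad (W := W) (α := α) (p := p) (χ := χ) (x₀ := x₀) (xs := xs)
      (ξ := ξ) (θ := θ) hF hg t).mono hle' le_rfl).const_smul α)).sub
      ((measurable_linearMap (gossipOp W χ d)).comp hs)).sub
      (((measurable_runNoise (W := W) (α := α) (p := p) (χ := χ) (x₀ := x₀)
      (ξ := ξ) (θ := θ) hF hg t).mono hle le_rfl).const_smul α)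
    exact hs.add (Measurable.ite (h2 (measurableSet_singleton true)) (hz.const_smul p)
      measurable_const)

variable [MeasurableSpace Ω] {P : Measure Ω}

omit [∀ i, MeasurableSpace (Ξ i)] in
theorem memLp_runNoise
    (hU : HasUnbiasedGradients f σ P (fun t i ω => (randomIterates F W α p χ x₀ ξ θ t ω).1 i)
      (fun t i ω => stochGrad F (randomIterates F W α p χ x₀ ξ θ t ω).1 (fun j => ξ t j ω) i))
    (t : ℕ) : MemLp (runNoise f F W α p χ x₀ ξ θ t) 2 P :=
  memLp_piLp_iff.2 fun i => hU.memLp t i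

variable [IsProbabilityMeasure P]

/-- Only the noise is assumed square integrable. The rest inherits this by induction from a
deterministic start: gradient errors grow at most linearly, and each update is linear up to the
indicator of the coin. -/
theorem memLp_run (hF : IsStochasticLoss f D F) (hS : IsSampling D p P ξ θ)
    (hL : 0 ≤ L) (hg : ∀ i, IsSmooth L (f i))
    (hU : HasUnbiasedGradients f σ P (fun t i ω => (randomIterates F W α p χ x₀ ξ θ t ω).1 i)
      (fun t i ω => stochGrad F (randomIterates F W α p χ x₀ ξ θ t ω).1 (fun j => ξ t j ω) i))
    (hG : IsGossip (gossipOp W χ d) (centerOp n d) w c) (hn : 0 < n)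
    (hs₀ : gossipOp W χ d s₀ = α • optGrad f xs) (t : ℕ) :
    MemLp (runX F W α p χ x₀ xs ξ θ t) 2 P ∧ MemLp (runS f F W α p χ x₀ xs s₀ ξ θ t) 2 P
      ∧ MemLp (runGrad f F W α p χ x₀ xs ξ θ t) 2 P := by
  have hgrad : ∀ t, MemLp (runX F W α p χ x₀ xs ξ θ t) 2 P →
      MemLp (runGrad f F W α p χ x₀ xs ξ θ t) 2 P := fun t hx =>
    hx.of_le_mul ((measurable_runGrad hF hg t).mono (hS.history_le _) le_rfl).aestronglyMeasurable
      (ae_of_all _ fun ω => norm_gradErr_le hL hg _)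
  suffices h : MemLp (runX F W α p χ x₀ xs ξ θ t) 2 P
      ∧ MemLp (runS f F W α p χ x₀ xs s₀ ξ θ t) 2 P from ⟨h.1, h.2, hgrad t h.1⟩
  induction t with
  | zero => exact ⟨memLp_const (primalErr xs fun _ => x₀), memLp_const s₀⟩
  | succ t ih =>
    obtain ⟨hx, hs⟩ := ih
    have hz := ((hx.sub ((hgrad t hx).const_smul α)).sub
      (hs.linearMap_comp (gossipOp W χ d))).sub ((memLp_runNoise hU t).const_smul α)
    have hθ : MeasurableSet {ω | θ t ω = true} :=
      hS.measurable_coin t (measurableSet_singleton true)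
    have hind1 := (hz.linearMap_comp (gossipOp W χ d)).indicator hθ
    have hind2 := (hz.const_smul p).indicator hθ
    constructor
    · refine (hz.sub hind1).ae_eq (ae_of_all _ fun ω => ?_)
      rw [runX_succ hG hn hs₀]
      simp [Set.indicator_apply]
    · refine (hs.add hind2).ae_eq (ae_of_all _ fun ω => ?_)
      rw [runS_succ]
      simp [Set.indicator_apply]

/-- The index set `S` is left free for two uses: the past alone, and the past with another node's
current sample. -/
theorem integral_inner_runNoise_apply (hF : IsStochasticLoss f D F) (hS : IsSampling D p P ξ θ)
    (hg : ∀ i, IsSmooth L (f i))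
    (hU : HasUnbiasedGradients f σ P (fun t i ω => (randomIterates F W α p χ x₀ ξ θ t ω).1 i)
      (fun t i ω => stochGrad F (randomIterates F W α p χ x₀ ξ θ t ω).1 (fun j => ξ t j ω) i))
    {t : ℕ} (hx : MemLp (runGrad f F W α p χ x₀ xs ξ θ t) 2 P) {S : Set ((ℕ × Fin n) ⊕ ℕ)}
    (hpast : pastIndex n t ⊆ S) {i : Fin n} (hi : Sum.inl (t, i) ∉ S) {A : Ω → Vec d}
    (hA : Measurable[history ξ θ S] A) (hA2 : MemLp A 2 P) :
    ∫ ω, inner ℝ (A ω) (runNoise f F W α p χ x₀ ξ θ t ω i) ∂P = 0 := by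
  have hxm : Measurable[history ξ θ S] fun ω => (randomIterates F W α p χ x₀ ξ θ t ω).1 i :=
    (measurable_pi_apply i).comp (measurable_fst.comp
      ((measurable_randomIterates hF t).mono (history_mono hpast) le_rfl))
  have hgi : MemLp (fun ω => gradient (f i) ((randomIterates F W α p χ x₀ ξ θ t ω).1 i)) 2 P := by
    refine ((memLp_piLp_iff.1 hx i).add (memLp_const (gradient (f i) xs))).ae_eq
      (ae_of_all _ fun ω => ?_)
    simp [runGrad, gradErr]
  have hint : Integrable (fun ω => stochGrad F (randomIterates F W α p χ x₀ ξ θ t ω).1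
      (fun j => ξ t j ω) i) P := by
    refine (((hU.memLp t i).add hgi).ae_eq (ae_of_all _ fun ω => ?_)).integrable (by norm_num)
    simp
  exact integral_inner_noise_eq_zero (hS.history_le S) (hS.measurable_sample t i)
    (hS.indep_history hi) hA hxm hA2 (hF.measurable_gradient i) (hg i).measurable_gradient
    (hU.unbiased t i) hint (hU.memLp t i)

theorem isRun (hF : IsStochasticLoss f D F) (hS : IsSampling D p P ξ θ)
    (hμ : 0 < μ) (hL : 0 < L) (hg : ∀ i, IsSmooth L (f i)) (hc : ∀ i, IsStronglyConvex μ (f i))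
    (hmin : ∀ x, globalLoss f xs ≤ globalLoss f x) (hα : 0 < α) (hαL : α * L ≤ 1 / 2)
    (hU : HasUnbiasedGradients f σ P (fun t i ω => (randomIterates F W α p χ x₀ ξ θ t ω).1 i)
      (fun t i ω => stochGrad F (randomIterates F W α p χ x₀ ξ θ t ω).1 (fun j => ξ t j ω) i))
    (hG : IsGossip (gossipOp W χ d) (centerOp n d) w c) (hn : 0 < n)
    (hs₀ : gossipOp W χ d s₀ = α • optGrad f xs) :
    IsRun (gossipOp W χ d) (centerOp n d) α p L μ P (fun t => history ξ θ (pastIndex n t))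
      (fun t => history ξ θ (presentIndex n t)) (runX F W α p χ x₀ xs ξ θ)
      (runS f F W α p χ x₀ xs s₀ ξ θ) (runGrad f F W α p χ x₀ xs ξ θ)
      (runNoise f F W α p χ x₀ ξ θ) θ where
  past_le t := history_mono (pastIndex_subset_presentIndex n t)
  le t := hS.history_le _
  measurable_x := measurable_runX hF
  measurable_s := measurable_runS hF hg
  measurable_grad := measurable_runGrad hF hg
  measurable_noise := measurable_runNoise hF hg
  memLp_x t := (memLp_run hF hS hL.le hg hU hG hn hs₀ t).1
  memLp_s t := (memLp_run hF hS hL.le hg hU hG hn hs₀ t).2.1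
  memLp_grad t := (memLp_run hF hS hL.le hg hU hG hn hs₀ t).2.2
  memLp_noise := memLp_runNoise hU
  orthogonal t A hA hA2 := by
    have hA2i := memLp_piLp_iff.1 hA2
    have hνi := memLp_piLp_iff.1 (memLp_runNoise hU t)
    have e : ∀ ω, inner ℝ (A ω) (runNoise f F W α p χ x₀ ξ θ t ω)
        = ∑ i, inner ℝ (A ω i) (runNoise f F W α p χ x₀ ξ θ t ω i) := fun ω => PiLp.inner_apply _ _
    rw [integral_congr_ae (ae_of_all _ e), integral_finsetSum _ fun i _ => integrable_inner_of_memLp (hA2i i) (hνi i)]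
    refine Finset.sum_eq_zero fun i _ => ?_
    have hAi : Measurable[history ξ θ (pastIndex n t)] fun ω => A ω i :=
      (measurable_pi_apply i).comp ((WithLp.measurable_ofLp 2 _).comp hA)
    exact integral_inner_runNoise_apply hF hS hg hU
      (memLp_run hF hS hL.le hg hU hG hn hs₀ t).2.2 subset_rfl (lt_irrefl t) hAi (hA2i i)
  measurable_coin := hS.measurable_coin
  indep_coin t := by
    refine hS.indep_history (j := Sum.inr t) ?_
    rintro (h | ⟨i, hi⟩)
    · exact lt_irrefl t h
    · cases hi
  law_coin := hS.law_coin
  x_succ := runX_succ hG hn hs₀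
  s_succ := runS_succ
  norm_step t ω := norm_primalErr_step_sq_le hμ hL hg hc hα hαL _
  norm_grad t ω := norm_gradErr_le hL.le hg _
  norm_mean_step t ω := norm_mean_primalErr_step_sq_le hn hμ hL hg hc hmin hα hαL _

omit [∀ i, MeasurableSpace (Ξ i)] [IsProbabilityMeasure P] in
theorem integral_norm_runNoise_sq_eq
    (hU : HasUnbiasedGradients f σ P (fun t i ω => (randomIterates F W α p χ x₀ ξ θ t ω).1 i)
      (fun t i ω => stochGrad F (randomIterates F W α p χ x₀ ξ θ t ω).1 (fun j => ξ t j ω) i))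
    (t : ℕ) :
    ∫ ω, ‖runNoise f F W α p χ x₀ ξ θ t ω‖ ^ 2 ∂P
      = ∑ i, ∫ ω, ‖runNoise f F W α p χ x₀ ξ θ t ω i‖ ^ 2 ∂P := by
  have hνi := memLp_piLp_iff.1 (memLp_runNoise hU t)
  rw [integral_congr_ae (ae_of_all _ fun ω => PiLp.norm_sq_eq_of_L2 _ _)]
  exact integral_finsetSum _ fun i _ => (hνi i).integrable_norm_sq

omit [∀ i, MeasurableSpace (Ξ i)] [IsProbabilityMeasure P] in
theorem integral_norm_runNoise_sq_le
    (hU : HasUnbiasedGradients f σ P (fun t i ω => (randomIterates F W α p χ x₀ ξ θ t ω).1 i)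
      (fun t i ω => stochGrad F (randomIterates F W α p χ x₀ ξ θ t ω).1 (fun j => ξ t j ω) i))
    (hn : 0 < n) (t : ℕ) :
    ∫ ω, ‖runNoise f F W α p χ x₀ ξ θ t ω‖ ^ 2 ∂P ≤ n * σ ^ 2 := by
  rw [integral_norm_runNoise_sq_eq hU]
  have h := hU.variance_le t
  have hn' : (0 : ℝ) < n := by positivity
  rw [div_mul_eq_mul_div, one_mul, div_le_iff₀ hn', mul_comm] at h
  exact h

/-- Averaging over the nodes divides the variance by `n`. -/
theorem integral_norm_mean_runNoise_sq_le (hF : IsStochasticLoss f D F)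
    (hS : IsSampling D p P ξ θ) (hg : ∀ i, IsSmooth L (f i))
    (hU : HasUnbiasedGradients f σ P (fun t i ω => (randomIterates F W α p χ x₀ ξ θ t ω).1 i)
      (fun t i ω => stochGrad F (randomIterates F W α p χ x₀ ξ θ t ω).1 (fun j => ξ t j ω) i))
    (hn : 0 < n) {t : ℕ} (hx : MemLp (runGrad f F W α p χ x₀ xs ξ θ t) 2 P) :
    ∫ ω, ‖runNoise f F W α p χ x₀ ξ θ t ω - centerOp n d (runNoise f F W α p χ x₀ ξ θ t ω)‖ ^ 2 ∂P
      ≤ σ ^ 2 := by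
  have hνi := memLp_piLp_iff.1 (memLp_runNoise hU t)
  have hn' : (0 : ℝ) < n := by positivity
  have e1 : ∀ ω, ‖runNoise f F W α p χ x₀ ξ θ t ω
      - centerOp n d (runNoise f F W α p χ x₀ ξ θ t ω)‖ ^ 2
      = 1 / n * ∑ i, ∑ j, inner ℝ (runNoise f F W α p χ x₀ ξ θ t ω i)
          (runNoise f F W α p χ x₀ ξ θ t ω j) := by
    intro ω
    rw [norm_sub_centerOp_sq, nodeMean, norm_smul, mul_pow, ← real_inner_self_eq_norm_sq (∑ i, _),
      sum_inner, Real.norm_eq_abs, sq_abs]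
    simp only [inner_sum]
    field_simp
  -- The noise of node `i` is treated as known, while the sample of node `j` is still fresh.
  have hij : ∀ i j : Fin n, i ≠ j → ∫ ω, inner ℝ (runNoise f F W α p χ x₀ ξ θ t ω i)
      (runNoise f F W α p χ x₀ ξ θ t ω j) ∂P = 0 := by
    intro i j hne
    refine integral_inner_runNoise_apply hF hS hg hU hx
      (S := pastIndex n t ∪ {Sum.inl (t, i)}) Set.subset_union_left ?_
      (measurable_noise_apply hF hg t Set.subset_union_left (Or.inr rfl)) (hνi i)
    rintro (h | h)
    · exact lt_irrefl t h
    · rw [Set.mem_singleton_iff] at h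
      exact hne (by simpa using h.symm)
  have hint : ∀ i j : Fin n, Integrable (fun ω => inner ℝ (runNoise f F W α p χ x₀ ξ θ t ω i)
      (runNoise f F W α p χ x₀ ξ θ t ω j)) P := fun i j => integrable_inner_of_memLp (hνi i) (hνi j)
  simp only [e1]
  rw [integral_const_mul, integral_finsetSum _ fun i _ => integrable_finsetSum _ fun j _ => hint i j]
  refine le_trans (le_of_eq ?_) (hU.variance_le t)
  congr 1
  refine Finset.sum_congr rfl fun i _ => ?_
  rw [integral_finsetSum _ fun j _ => hint i j, Finset.sum_eq_single i
    (fun j _ hj => hij i j hj.symm) (by simp)]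
  exact integral_congr_ae (ae_of_all _ fun ω => real_inner_self_eq_norm_sq _)

end Main

end ProxSkip

end

-- The main theorem

open ProxSkip in
theorem theorem2 :
    -- the absolute constant of the `O`-term
    ∃ C : ℝ, 0 < C ∧
    ∀ (n : ℕ) (hn : 2 ≤ n) (d : ℕ)
      (W : Matrix (Fin n) (Fin n) ℝ) (hW : IsMixingMatrix W)
      (f : Fin n → Vec d → ℝ) (L μ : ℝ), 0 < μ → μ ≤ L →
      (∀ i, IsSmooth L (f i)) → (∀ i, IsStronglyConvex μ (f i)) →
    ∀ xstar : Vec d, (∀ x, globalLoss f xstar ≤ globalLoss f x) →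
    ∀ α p χ : ℝ, 0 < α → α ≤ 1 / (2 * L) → 0 < p → p ≤ 1 →
      χ > max (1 / p) (max (36 / (1 - hW.lambda2 hn)) (72 * (1 - p) / (1 - hW.lambda2 hn))) →
    ∀ x₀ : Vec d,
      gammaS (hW.lambda2 hn) p χ < 1 ∧
      zetaTilde (hW.lambda2 hn) p χ α μ < 1 ∧
      -- `a₀` depends neither on `t` nor on the stochastic gradients and their variance
      ∃ a₀ : ℝ,
        ∀ (Ξ : Fin n → Type u) [∀ i, MeasurableSpace (Ξ i)] (D : ∀ i, Measure (Ξ i))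
          (F : ∀ i, Vec d → Ξ i → ℝ), IsStochasticLoss f D F →
        ∀ (Ω : Type v) [MeasurableSpace Ω] (P : Measure Ω) [IsProbabilityMeasure P]
          (ξ : ℕ → ∀ i, Ω → Ξ i) (θ : ℕ → Ω → Bool), IsSampling D p P ξ θ →
        ∀ X : ℕ → Ω → Stack n d,
          (∀ t ω, X t ω =
            (iterates F W α p χ x₀ (fun s i => ξ s i ω) (fun s => θ s ω) t).1) →
        ∀ σ : ℝ, 0 ≤ σ →
          HasUnbiasedGradients f σ P (fun t i ω => X t ω i)
            (fun t i ω => stochGrad F (X t ω) (fun j => ξ t j ω) i) →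
        ∀ t : ℕ,
          Integrable (fun ω => ‖nodeMean (X (t + 1) ω) - xstar‖ ^ 2) P ∧
          ∫ ω, ‖nodeMean (X (t + 1) ω) - xstar‖ ^ 2 ∂P ≤
            zetaTilde (hW.lambda2 hn) p χ α μ ^ (t + 1) * a₀ +
            C * (α ^ 4 * σ ^ 2 * L ^ 3 * χ ^ 4 /
                  (μ * p ^ 2 * (1 - hW.lambda2 hn) ^ 2 * (1 - zeta (hW.lambda2 hn) p χ α μ)) +
                α ^ 2 * σ ^ 2 * L * χ ^ 3 / (μ * p ^ 2 * (1 - hW.lambda2 hn))) +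
            α * σ ^ 2 / (n * μ) := by
  refine ⟨200, by norm_num, ?_⟩
  intro n hn d W hW f L μ hμ hμL hg hc xs hmin α p χ hα hαL hp hp1 hχ x₀
  have hn0 : 0 < n := by omega
  have hn' : (0 : ℝ) < n := by positivity
  have hL : 0 < L := hμ.trans_le hμL
  have hlam := hW.lambda2_lt_one hn
  have hgap : 0 < 1 - hW.lambda2 hn := by linarith
  have hadm : IsAdmissible (hW.lambda2 hn) p χ α μ L := by
    refine ⟨hlam, hW.neg_one_le_lambda2 hn, hμ, hμL, hα, ?_, hp, hp1, ?_, ?_⟩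
    · rw [le_div_iff₀ (by positivity)] at hαL
      linarith
    · have := lt_of_le_of_lt (le_max_left _ _) hχ
      rw [div_lt_iff₀ hp] at this
      linarith
    · have := lt_of_le_of_lt ((le_max_left _ _).trans (le_max_right _ _)) hχ
      rwa [div_lt_iff₀ hgap] at this
  have hχ0 := hadm.chi_pos
  have hχ18 : 1 / χ ≤ 1 / 18 := one_div_le_one_div_of_le (by norm_num) hadm.chi_gt.le
  have hG := hW.isGossip hn hχ0 d
  -- With this start, `Y⁰ = 0` reads `H s₀ - α ∇f(x⋆) = 0`. It is chosen before any randomness, as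
  -- `a₀` requires.
  obtain ⟨s₀, hs₀⟩ := hG.exists_apply_eq (y := α • optGrad f xs)
    (by rw [map_smul, centerOp_optGrad hn0 hg hmin])
  refine ⟨hadm.gammaS_lt_one, hadm.zetaTilde_lt_one, ?_⟩
  let y₀ : NodeSpace n d := primalErr xs fun _ => x₀
  obtain ⟨a₀, ha₀⟩ := hadm.exists_bound (E0 := ‖y₀ - centerOp n d y₀‖ ^ 2)
    (V0 := lyapunov (gossipOp W χ d) (centerOp n d) p y₀ s₀) (by positivity)
    (hG.lyapunov_nonneg p y₀ s₀)
  -- The recursions bound `n` times the squared error of the average, so every term is divided by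
  -- `n`.
  refine ⟨a₀ / n, fun Ξ _ D F hF Ω _ P _ ξ θ hS X hX σ _ hU t => ?_⟩
  obtain rfl : X = fun t ω => (randomIterates F W α p χ x₀ ξ θ t ω).1 :=
    funext fun t => funext fun ω => hX t ω
  have hrun := isRun (μ := μ) hF hS hμ hL hg hc hmin hα hadm.step_le hU hG hn0 hs₀
  have e : ∀ t ω, ‖nodeMean (randomIterates F W α p χ x₀ ξ θ t ω).1 - xs‖ ^ 2
      = 1 / n * ‖runX F W α p χ x₀ xs ξ θ t ω
          - centerOp n d (runX F W α p χ x₀ xs ξ θ t ω)‖ ^ 2 := by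
    intro t ω
    rw [runX, norm_sub_centerOp_sq, nodeMean_primalErr hn0]
    field_simp
  have hx := hrun.memLp_x (t + 1)
  have hxQ : MemLp (fun ω => runX F W α p χ x₀ xs ξ θ (t + 1) ω
      - centerOp n d (runX F W α p χ x₀ xs ξ θ (t + 1) ω)) 2 P :=
    hx.sub (hx.linearMap_comp (centerOp n d))
  simp only [e]
  refine ⟨hxQ.integrable_norm_sq.const_mul _, ?_⟩
  have hpw : p * ((1 - hW.lambda2 hn) / (2 * χ)) ≤ 1 :=
    mul_le_one₀ hp1 hadm.gapw_pos.le (hadm.gapw_lt.le.trans (by norm_num))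
  -- The stacked noise has second moment at most `nσ²`, its average component at most `σ²`: division
  -- by `n` leaves `σ²` in the consensus terms and `σ²/n` in the last one.
  have hbound := ha₀
    (fun t => ∫ ω, ‖runX F W α p χ x₀ xs ξ θ t ω
      - centerOp n d (runX F W α p χ x₀ xs ξ θ t ω)‖ ^ 2 ∂P)
    (fun t => ∫ ω, lyapunov (gossipOp W χ d) (centerOp n d) p (runX F W α p χ x₀ xs ξ θ t ω)
      (runS f F W α p χ x₀ xs s₀ ξ θ t ω) ∂P)
    (n * σ ^ 2) (σ ^ 2) (by positivity) (by positivity)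
    (by
      change ∫ ω, ‖y₀ - centerOp n d y₀‖ ^ 2 ∂P = _
      simp)
    (by
      change ∫ ω, lyapunov (gossipOp W χ d) (centerOp n d) p y₀ s₀ ∂P = _
      simp)
    (fun t => (hrun.integral_total_succ_le hG hp (hχ18.trans (by norm_num)) (le_max_left _ _)
      (le_max_right _ _) t).trans (by gcongr; exact integral_norm_runNoise_sq_le hU hn0 t))
    (fun t => (hrun.integral_lyapunov_contract hG hp hp1 hχ18 hpw t).trans
      (by gcongr; exact integral_norm_runNoise_sq_le hU hn0 t))
    (fun t => (hrun.integral_mean_succ_le hG (by positivity) t).trans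
      (by gcongr; exact integral_norm_mean_runNoise_sq_le hF hS hg hU hn0 (hrun.memLp_grad t)))
    (t + 1)
  rw [integral_const_mul]
  refine (mul_le_mul_of_nonneg_left hbound (by positivity)).trans (le_of_eq ?_)
  have hz : 1 - zeta (hW.lambda2 hn) p χ α μ ≠ 0 := by
    have := hadm.zeta_lt_one
    linarith
  field_simp
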